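/- Let $n>2$ and let $S_n$ be the symmetric group on $\{1,\dots,n\}$, with length function $\ell$ with respect to the adjacent transpositions $\sigma_i=(i,i+1)$, $1\le i\le n-1$. The product $\pi\tau$ denotes composition of functions, $(\pi\tau)(i)=\pi(\tau(i))$. The (right) weak order on $S_n$ is defined by $\pi\le\tau$ if and only if $\ell(\pi)+\ell(\pi^{-1}\tau)=\ell(\tau)$. A permutation $\pi\in S_n$, written as the word $\pi(1)\pi(2)\cdots\pi(n)$, is called unimodal if the set of letters of every nonempty prefix of this word is an interval $\{a,a+1,\dots,b\}$ of integers, or the set of letters of every nonempty suffix is such an interval. Let $\mathrm{Weak}(\mathcal U_n)$ be the subposet of the weak order on $S_n$ induced by the set $\mathcal U_n$ of unimodal permutations. A standard Young tableau of shifted staircase shape is a bijective filling of the $\binom n2$ boxes $(i,j)$, $1\le i<j\le n$ (row $i$, column $j$), with the numbers $1,\dots,\binom n2$, such that the entries increase along each row and down each column. Then the number of maximal chains in $\mathrm{Weak}(\mathcal U_n)$ is equal to twice the number of standard Young tableaux of shifted staircase shape, and hence equal to $$ 2\binom{n}{2}!\cdot\prod_{i=0}^{n-2}\frac{i!}{(2i+1)!}.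 $$ -/

import Mathlib

open scoped Nat

/-- The simple reflections of the symmetric group on `Fin n`: the adjacent transpositions. -/
def IsSimpleReflection {n : ℕ} (s : Equiv.Perm (Fin n)) : Prop :=
  ∃ i j : Fin n, (i : ℕ) + 1 = (j : ℕ) ∧ s = Equiv.swap i j

/-- `IsWordFor l π`: the list `l` of simple reflections has product `π`. -/
def IsWordFor {n : ℕ} (l : List (Equiv.Perm (Fin n))) (π : Equiv.Perm (Fin n)) : Prop :=
  (∀ s ∈ l, IsSimpleReflection s) ∧ l.prod = π

/-- The Coxeter length `ℓ(π)`: the least length of a word in the simple reflections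
with product `π`. -/
noncomputable def coxeterLength {n : ℕ} (π : Equiv.Perm (Fin n)) : ℕ :=
  sInf {k : ℕ | ∃ l : List (Equiv.Perm (Fin n)), IsWordFor l π ∧ l.length = k}

/-- The adjacent transpositions generate, so the infimum in `coxeterLength` is a minimum. -/
theorem exists_isWordFor {n : ℕ} (π : Equiv.Perm (Fin n)) :
    ∃ l : List (Equiv.Perm (Fin n)), IsWordFor l π := by
  cases n with
  | zero => exact ⟨[], by simp, Subsingleton.elim _ _⟩
  | succ m =>
    have h : π ∈ Submonoid.closure
        (Set.range fun i : Fin m => Equiv.swap i.castSucc i.succ) := by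
      rw [Equiv.Perm.mclosure_swap_castSucc_succ]; trivial
    obtain ⟨l, hl, hp⟩ := Submonoid.exists_list_of_mem_closure h
    refine ⟨l, fun s hs => ?_, hp⟩
    obtain ⟨i, rfl⟩ := hl s hs
    exact ⟨i.castSucc, i.succ, by simp, rfl⟩

theorem exists_reduced_word {n : ℕ} (π : Equiv.Perm (Fin n)) :
    ∃ l : List (Equiv.Perm (Fin n)), IsWordFor l π ∧ l.length = coxeterLength π := by
  obtain ⟨l, hl⟩ := exists_isWordFor π
  exact Nat.sInf_mem (s := {k : ℕ | ∃ l, IsWordFor l π ∧ l.length = k}) ⟨_, l, hl, rfl⟩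

theorem coxeterLength_le_of_isWordFor {n : ℕ} {π : Equiv.Perm (Fin n)}
    {l : List (Equiv.Perm (Fin n))} (h : IsWordFor l π) : coxeterLength π ≤ l.length :=
  Nat.sInf_le ⟨l, h, rfl⟩

theorem coxeterLength_one {n : ℕ} : coxeterLength (1 : Equiv.Perm (Fin n)) = 0 :=
  Nat.le_zero.mp (coxeterLength_le_of_isWordFor (l := []) ⟨by simp, rfl⟩)

theorem eq_one_of_coxeterLength_eq_zero {n : ℕ} {π : Equiv.Perm (Fin n)}
    (h : coxeterLength π = 0) : π = 1 := by
  obtain ⟨l, hl, hlen⟩ := exists_reduced_word π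
  rw [h, List.length_eq_zero_iff] at hlen
  subst hlen
  exact hl.2.symm

theorem coxeterLength_mul_le {n : ℕ} (π τ : Equiv.Perm (Fin n)) :
    coxeterLength (π * τ) ≤ coxeterLength π + coxeterLength τ := by
  obtain ⟨l, hl, h1⟩ := exists_reduced_word π
  obtain ⟨m, hm, h2⟩ := exists_reduced_word τ
  rw [← h1, ← h2, ← List.length_append]
  refine coxeterLength_le_of_isWordFor ⟨fun s hs => ?_, by rw [List.prod_append, hl.2, hm.2]⟩
  rcases List.mem_append.mp hs with h | h
  · exact hl.1 s h
  · exact hm.1 s h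

/-- The poset `Weak(S_n)`: the permutations of `Fin n` with the right weak order. The product
of permutations is composition of functions, so multiplying `π` on the right by a simple
reflection exchanges two neighbouring letters of the word `π 0, π 1, …, π (n-1)`. -/
def WeakPerm (n : ℕ) : Type := Equiv.Perm (Fin n)

/-- The permutation underlying an element of `Weak(S_n)`. -/
def WeakPerm.toPerm {n : ℕ} (π : WeakPerm n) : Equiv.Perm (Fin n) := π

/-- The right weak order: `π ≤ τ` iff `ℓ(π) + ℓ(π⁻¹ τ) = ℓ(τ)`. -/
noncomputable instance WeakPerm.instPartialOrder (n : ℕ) : PartialOrder (WeakPerm n) where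
  le π τ := coxeterLength π.toPerm + coxeterLength (π.toPerm⁻¹ * τ.toPerm) =
    coxeterLength τ.toPerm
  le_refl π := by simp [coxeterLength_one]
  le_trans π τ ρ h1 h2 := by
    have h3 := coxeterLength_mul_le (π.toPerm⁻¹ * τ.toPerm) (τ.toPerm⁻¹ * ρ.toPerm)
    have h4 := coxeterLength_mul_le π.toPerm (π.toPerm⁻¹ * ρ.toPerm)
    have h5 : π.toPerm⁻¹ * τ.toPerm * (τ.toPerm⁻¹ * ρ.toPerm) = π.toPerm⁻¹ * ρ.toPerm := by
      group
    rw [h5] at h3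
    rw [mul_inv_cancel_left] at h4
    omega
  le_antisymm π τ h1 h2 := by
    have h3 : coxeterLength (π.toPerm⁻¹ * τ.toPerm) = 0 := by omega
    have h4 : π.toPerm = τ.toPerm := inv_mul_eq_one.mp (eq_one_of_coxeterLength_eq_zero h3)
    exact h4

/-- A set of letters is an interval: it is `{a, a+1, …, b}` for some `a ≤ b`. -/
def IsLetterInterval {n : ℕ} (A : Set (Fin n)) : Prop :=
  ∃ a b : Fin n, a ≤ b ∧ A = Set.Icc a b

/-- A permutation is unimodal if every (nonempty) prefix of its word forms an interval, or
every (nonempty) suffix of its word forms an interval. -/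
def IsUnimodal {n : ℕ} (π : Equiv.Perm (Fin n)) : Prop :=
  (∀ k : Fin n, IsLetterInterval (π '' Set.Iic k)) ∨
    (∀ k : Fin n, IsLetterInterval (π '' Set.Ici k))

/-- The poset `Weak(U_n)`: the subposet of `Weak(S_n)` induced by the unimodal permutations. -/
abbrev WeakUnimodal (n : ℕ) : Type := {π : WeakPerm n // IsUnimodal π.toPerm}

/-- The boxes of the shifted staircase shape with rows of lengths `n-1, n-2, …, 1`, each row
indented by one box relative to the previous one: the boxes in row `i` and column `j`, `i < j`,
with rows and columns numbered by `Fin n`. -/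
abbrev StaircaseBox (n : ℕ) : Type := {c : Fin n × Fin n // c.1 < c.2}

/-- A standard Young tableau of shifted staircase shape: a bijective filling of the
`n.choose 2` boxes, with entries strictly increasing along each row and down each column.
The entries are numbered from `0`. -/
structure ShiftedStaircaseSYT (n : ℕ) where
  entry : StaircaseBox n ≃ Fin (n.choose 2)
  row_lt : ∀ c d : StaircaseBox n, c.1.1 = d.1.1 → c.1.2 < d.1.2 → entry c < entry d
  col_lt : ∀ c d : StaircaseBox n, c.1.2 = d.1.2 → c.1.1 < d.1.1 → entry c < entry d

/-! The inversions of a product form a symmetric difference, so lengths add exactly when inversions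
are contained in one another: the weak order is inclusion of inversion sets
(`weakPerm_le_iff_inversionBoxes`). Read an inversion x < y as the box (x, y) of the staircase. All
prefixes are intervals iff, of any three letters, the middle one never comes last; this makes the
inversion set a lower set of boxes, and every lower set arises (`prefixUnimodalOrderIso`). Maximal
chains of lower sets are linear extensions of the boxes, that is, tableaux.

Conjugation by the longest permutation carries the suffix case to the prefix case. The two lattices
share only the identity and the reversal. Any other element of the first inverts the two smallest
letters but not the two largest, any other element of the second does the opposite, so the two are
incomparable. For n > 2 each maximal chain therefore lies in exactly one lattice, whence the factor
2 (`card_flag_weakUnimodal`).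

The product formula is proved for all shifted shapes, as |l|! ∏ 1/l_i! ∏ (l_i - l_j)/(l_i + l_j),
the pairs running over nonempty rows i < j. Removing the box with the largest entry gives a
recursion for the count. The weight obeys the same recursion by an identity of rational functions
that comes from Lagrange interpolation (`sum_mul_prod_partRatio`). -/

/-! ### The weak order as inclusion of inversion sets -/

section WeakOrder

variable {n : ℕ}

/-- The ordered pairs of distinct letters whose relative order in the word of `π` is not the
natural one; every inversion contributes two pairs. -/
def inversionPairs (π : Equiv.Perm (Fin n)) : Finset (Fin n × Fin n) :=
  Finset.univ.filter fun p => ¬(p.1 < p.2 ↔ π⁻¹ p.1 < π⁻¹ p.2)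

theorem mem_inversionPairs {π : Equiv.Perm (Fin n)} {p : Fin n × Fin n} :
    p ∈ inversionPairs π ↔ ¬(p.1 < p.2 ↔ π⁻¹ p.1 < π⁻¹ p.2) := by
  simp [inversionPairs]

theorem inversionPairs_one : inversionPairs (1 : Equiv.Perm (Fin n)) = ∅ := by
  ext p; simp [mem_inversionPairs]

/-- Compare a pair with its image under `π⁻¹`, then with the image of that under `τ⁻¹`: the relative
order changes overall iff exactly one of the two stages changes it. -/
theorem inversionPairs_mul (π τ : Equiv.Perm (Fin n)) :
    inversionPairs (π * τ) = symmDiff (inversionPairs π)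
      ((inversionPairs τ).map (Equiv.prodCongr π π).toEmbedding) := by
  ext p
  have : p ∈ (inversionPairs τ).map (Equiv.prodCongr π π).toEmbedding ↔
      ¬(π⁻¹ p.1 < π⁻¹ p.2 ↔ τ⁻¹ (π⁻¹ p.1) < τ⁻¹ (π⁻¹ p.2)) := by
    rw [Finset.mem_map_equiv, mem_inversionPairs]
    rfl
  rw [Finset.mem_symmDiff, this, mem_inversionPairs, mem_inversionPairs, mul_inv_rev]
  simp only [Equiv.Perm.mul_apply]
  tauto

theorem inversionPairs_swap {i j : Fin n} (h : (i : ℕ) + 1 = j) :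
    inversionPairs (Equiv.swap i j) = {(i, j), (j, i)} := by
  ext ⟨a, b⟩
  rw [mem_inversionPairs]
  simp only [Equiv.swap_inv, Finset.mem_insert, Finset.mem_singleton, Prod.mk.injEq,
    Equiv.swap_apply_def]
  grind

theorem card_symmDiff_le {α : Type*} [DecidableEq α] (s t : Finset α) :
    (symmDiff s t).card ≤ s.card + t.card :=
  (Finset.card_le_card (fun _ hx => by
    rw [Finset.mem_symmDiff] at hx; rw [Finset.mem_union]; tauto)).trans (Finset.card_union_le s t)

theorem card_symmDiff_eq_iff {α : Type*} [DecidableEq α] (s t : Finset α) :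
    s.card + t.card = (symmDiff s t).card ↔ Disjoint s t := by
  have h1 : symmDiff s t = (s ∪ t) \ (s ∩ t) := by
    ext x; simp only [Finset.mem_symmDiff, Finset.mem_sdiff, Finset.mem_union, Finset.mem_inter]
    tauto
  have h2 := Finset.card_sdiff_add_card_eq_card
    (Finset.inter_subset_left.trans Finset.subset_union_left : s ∩ t ⊆ s ∪ t)
  have h3 := Finset.card_union_add_card_inter s t
  rw [h1, Finset.disjoint_iff_inter_eq_empty, ← Finset.card_eq_zero]
  omega

theorem card_inversionPairs_le (π : Equiv.Perm (Fin n)) :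
    (inversionPairs π).card ≤ 2 * coxeterLength π := by
  obtain ⟨l, ⟨hl, rfl⟩, hlen⟩ := exists_reduced_word π
  rw [← hlen]
  clear hlen
  induction l with
  | nil => simp [inversionPairs_one]
  | cons s l ih =>
    have h1 := ih fun t ht => hl t (List.mem_cons_of_mem _ ht)
    obtain ⟨i, j, hij, rfl⟩ := hl s List.mem_cons_self
    rw [List.prod_cons, inversionPairs_mul, List.length_cons]
    have h2 := card_symmDiff_le (inversionPairs (Equiv.swap i j))
      ((inversionPairs l.prod).map
        (Equiv.prodCongr (Equiv.swap i j) (Equiv.swap i j)).toEmbedding)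
    rw [Finset.card_map] at h2
    have h3 : (inversionPairs (Equiv.swap i j)).card ≤ 2 := by
      rw [inversionPairs_swap hij]; exact Finset.card_le_two
    omega

theorem eq_one_of_forall_adjacent_lt (π : Equiv.Perm (Fin n))
    (h : ∀ i j : Fin n, (i : ℕ) + 1 = j → π i < π j) : π = 1 := by
  cases n with
  | zero => exact Subsingleton.elim _ _
  | succ m =>
    have hm : StrictMono π := Fin.strictMono_iff_lt_succ.2 fun i => h _ _ (by simp)
    have h2 := Subsingleton.elim (hm.orderIsoOfSurjective π π.surjective) (OrderIso.refl _)
    ext1 i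
    exact congrArg (fun e : Fin (m + 1) ≃o Fin (m + 1) => e i) h2

/-- Sorting: exchanging the letters at an adjacent descent removes exactly two pairs at the cost of
one reflection. -/
theorem two_mul_coxeterLength_le (π : Equiv.Perm (Fin n)) :
    2 * coxeterLength π ≤ (inversionPairs π).card := by
  induction h : (inversionPairs π).card using Nat.strong_induction_on generalizing π with
  | _ k ih =>
    by_cases hπ : π = 1
    · simp [hπ, coxeterLength_one]
    obtain ⟨i, j, hij, hlt⟩ : ∃ i j : Fin n, (i : ℕ) + 1 = j ∧ ¬π i < π j := by
      by_contra! hc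
      exact hπ (eq_one_of_forall_adjacent_lt π hc)
    have hne : i ≠ j := by rintro rfl; omega
    have hlt' : π j < π i := lt_of_le_of_ne (not_lt.1 hlt) (fun h => hne (π.injective h.symm))
    have hij' : i < j := Fin.lt_def.2 (by omega)
    have hsub : (inversionPairs (Equiv.swap i j)).map (Equiv.prodCongr π π).toEmbedding ⊆
        inversionPairs π := by
      rw [inversionPairs_swap hij]
      intro p hp
      simp only [Finset.map_insert, Finset.map_singleton, Finset.mem_insert,
        Finset.mem_singleton] at hp
      rcases hp with rfl | rfl <;>
        simp [mem_inversionPairs, hlt', hij', hij'.le, hlt'.le]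
    have hcard : (inversionPairs (π * Equiv.swap i j)).card + 2 = (inversionPairs π).card := by
      have h2 := Finset.card_sdiff_add_card_eq_card hsub
      rw [Finset.card_map, inversionPairs_swap hij, Finset.card_pair (by simp [hne])] at h2
      rw [inversionPairs_mul, inversionPairs_swap hij, symmDiff_comm, ← h2]
      rw [inversionPairs_swap hij] at hsub
      rw [symmDiff_of_le hsub]
    have h3 := ih _ (by omega) (π * Equiv.swap i j) rfl
    have h4 := coxeterLength_mul_le (π * Equiv.swap i j) (Equiv.swap i j)
    have h5 : coxeterLength (Equiv.swap i j) ≤ 1 :=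
      coxeterLength_le_of_isWordFor (l := [Equiv.swap i j])
        ⟨by simpa using ⟨i, j, hij, rfl⟩, by simp⟩
    rw [mul_assoc, Equiv.swap_mul_self, mul_one] at h4
    omega

theorem card_inversionPairs (π : Equiv.Perm (Fin n)) :
    (inversionPairs π).card = 2 * coxeterLength π :=
  (card_inversionPairs_le π).antisymm (two_mul_coxeterLength_le π)

/-- The inversion pairs of `τ` are the symmetric difference of those of `π` and a set `A` of size
2ℓ(π⁻¹τ). Lengths add iff this union is disjoint, which means that nothing of `π` is cancelled. -/
theorem weakPerm_le_iff {π τ : WeakPerm n} :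
    π ≤ τ ↔ inversionPairs π.toPerm ⊆ inversionPairs τ.toPerm := by
  set A := (inversionPairs (π.toPerm⁻¹ * τ.toPerm)).map
    (Equiv.prodCongr π.toPerm π.toPerm).toEmbedding with hA
  have h1 : inversionPairs τ.toPerm = symmDiff (inversionPairs π.toPerm) A := by
    rw [hA, ← inversionPairs_mul, mul_inv_cancel_left]
  have h2 : A.card = 2 * coxeterLength (π.toPerm⁻¹ * τ.toPerm) := by
    rw [hA, Finset.card_map, card_inversionPairs]
  have h3 : π ≤ τ ↔ Disjoint (inversionPairs π.toPerm) A := by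
    rw [← card_symmDiff_eq_iff, ← h1, h2, card_inversionPairs, card_inversionPairs]
    change _ + _ = _ ↔ _
    omega
  rw [h3, h1, Finset.disjoint_left, Finset.subset_iff]
  simp only [Finset.mem_symmDiff]
  exact forall_congr' fun x => by tauto

/-- The boxes of the staircase given by the inversions of `π`. -/
def inversionBoxes (π : Equiv.Perm (Fin n)) : Set (StaircaseBox n) :=
  {c | π⁻¹ c.1.2 < π⁻¹ c.1.1}

theorem mem_inversionBoxes {π : Equiv.Perm (Fin n)} {c : StaircaseBox n} :
    c ∈ inversionBoxes π ↔ π⁻¹ c.1.2 < π⁻¹ c.1.1 := Iff.rfl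

theorem inversionPairs_subset_iff {π τ : Equiv.Perm (Fin n)} :
    inversionPairs π ⊆ inversionPairs τ ↔ inversionBoxes π ⊆ inversionBoxes τ := by
  have key : ∀ (σ : Equiv.Perm (Fin n)) (x y : Fin n), x < y →
      ((x, y) ∈ inversionPairs σ ↔ σ⁻¹ y < σ⁻¹ x) ∧
      ((y, x) ∈ inversionPairs σ ↔ σ⁻¹ y < σ⁻¹ x) := fun σ x y h => by
    have hne : σ⁻¹ x ≠ σ⁻¹ y := fun h' => h.ne (σ⁻¹.injective h')
    simp only [mem_inversionPairs, h, h.not_gt, true_iff, false_iff, not_lt]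
    exact ⟨⟨fun h' => lt_of_le_of_ne h' hne.symm, le_of_lt⟩, not_le⟩
  constructor
  · intro h c hc
    exact ((key τ _ _ c.2).1).1 (h (((key π _ _ c.2).1).2 hc))
  · rintro h ⟨x, y⟩ hp
    rcases lt_trichotomy x y with hxy | rfl | hxy
    · exact ((key τ _ _ hxy).1).2 (@h ⟨(x, y), hxy⟩ (((key π _ _ hxy).1).1 hp))
    · simp [mem_inversionPairs] at hp
    · exact ((key τ _ _ hxy).2).2 (@h ⟨(y, x), hxy⟩ (((key π _ _ hxy).2).1 hp))

theorem weakPerm_le_iff_inversionBoxes {π τ : WeakPerm n} :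
    π ≤ τ ↔ inversionBoxes π.toPerm ⊆ inversionBoxes τ.toPerm :=
  weakPerm_le_iff.trans inversionPairs_subset_iff

end WeakOrder

/-! ### Flags of lower sets and linear extensions -/

section LinearExtensions

/-- A strict total order on a finite type is the order given by some enumeration. -/
theorem exists_equiv_fin_of_isStrictTotalOrder {α : Type*} [Fintype α] {N : ℕ}
    (hN : Fintype.card α = N) (r : α → α → Prop) [IsStrictTotalOrder α r] :
    ∃ f : α ≃ Fin N, ∀ a b, r a b ↔ f a < f b := by
  classical
  let := linearOrderOfSTO r
  let e := Fintype.orderIsoFinOfCardEq α hN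
  exact ⟨e.symm.toEquiv, fun a b => (e.symm.lt_iff_lt (x := a) (y := b)).symm⟩

variable {P : Type*} [PartialOrder P] {N : ℕ}

/-- The initial segment of length `k` of a linear extension, as a lower set. -/
def initialLowerSet (f : {f : P ≃ Fin N // StrictMono f}) (k : ℕ) : LowerSet P where
  carrier := {p | (f.1 p : ℕ) < k}
  lower' _ _ hab ha := lt_of_le_of_lt (Fin.le_def.1 (f.2.monotone hab)) ha

theorem mem_initialLowerSet {f : {f : P ≃ Fin N // StrictMono f}} {k : ℕ} {p : P} :
    p ∈ initialLowerSet f k ↔ (f.1 p : ℕ) < k := Iff.rfl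

theorem initialLowerSet_mono (f : {f : P ≃ Fin N // StrictMono f}) :
    Monotone (initialLowerSet f) := fun _ _ hkl _ hp => lt_of_lt_of_le hp hkl

theorem ncard_initialLowerSet (f : {f : P ≃ Fin N // StrictMono f}) {k : ℕ} (hk : k ≤ N) :
    (initialLowerSet f k : Set P).ncard = k := by
  have h : (initialLowerSet f k : Set P) = f.1 ⁻¹' {i | (i : ℕ) < k} := rfl
  rw [h, Set.ncard_preimage_of_injective_subset_range f.1.injective (by simp)]
  have : {i : Fin N | (i : ℕ) < k} = ((Finset.univ.filter fun i : Fin N => (i : ℕ) < k) :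
      Finset (Fin N)) := by ext; simp
  rw [this, Set.ncard_coe_finset, Fin.card_filter_val_lt, min_eq_right hk]

/-- The flag of initial segments of a linear extension. -/
def linearExtensionFlag [Fintype P] (hN : Fintype.card P = N)
    (f : {f : P ≃ Fin N // StrictMono f}) : Flag (LowerSet P) where
  carrier := Set.range (initialLowerSet f)
  Chain' := by
    rintro _ ⟨k, rfl⟩ _ ⟨l, rfl⟩ -
    exact (le_total k l).imp (fun h => initialLowerSet_mono f h) (fun h => initialLowerSet_mono f h)
  max_chain' := by
    intro s hs hsub
    -- A further member of a larger chain is comparable with the initial segment of its own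
    -- cardinality, hence equal to it.
    refine hsub.antisymm fun J hJ => ⟨(J : Set P).ncard, ?_⟩
    have hle : (J : Set P).ncard ≤ N := by
      rw [← hN, ← Nat.card_eq_fintype_card]; exact Set.ncard_le_card _
    have hc := ncard_initialLowerSet f hle
    rcases hs.total (hsub ⟨_, rfl⟩) hJ with h | h
    · exact SetLike.coe_injective (Set.eq_of_subset_of_ncard_le h hc.ge)
    · exact (SetLike.coe_injective (Set.eq_of_subset_of_ncard_le h hc.le)).symm

/-- A chain has at most one member of each cardinality, so the flag determines every initial
segment, and these determine the values of the extension. -/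
theorem linearExtensionFlag_injective [Fintype P] (hN : Fintype.card P = N) :
    Function.Injective (linearExtensionFlag hN) := by
  intro f g hfg
  have hset : Set.range (initialLowerSet f) = Set.range (initialLowerSet g) :=
    congrArg Flag.carrier hfg
  have hk : ∀ k ≤ N, initialLowerSet f k = initialLowerSet g k := by
    intro k hk
    have hmem : initialLowerSet g k ∈ Set.range (initialLowerSet f) := hset ▸ ⟨k, rfl⟩
    have hf := ncard_initialLowerSet f hk
    have hg := ncard_initialLowerSet g hk
    rcases (linearExtensionFlag hN f).chain_le.total ⟨k, rfl⟩ hmem with h | h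
    · exact SetLike.coe_injective (Set.eq_of_subset_of_ncard_le h (by rw [hf, hg]))
    · exact (SetLike.coe_injective (Set.eq_of_subset_of_ncard_le h (by rw [hf, hg]))).symm
  apply Subtype.ext
  ext p
  apply le_antisymm
  · have : p ∈ initialLowerSet f (g.1 p + 1) := by
      rw [hk _ (g.1 p).2]; exact Nat.lt_succ_self _
    exact Nat.lt_succ_iff.1 this
  · have : p ∈ initialLowerSet g (f.1 p + 1) := by
      rw [← hk _ (f.1 p).2]; exact Nat.lt_succ_self _
    exact Nat.lt_succ_iff.1 this

/-- Two distinct elements are separated by some member of a flag of lower sets. -/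
theorem Flag.exists_separating_lowerSet [Finite P] (C : Flag (LowerSet P)) {p q : P}
    (hpq : p ≠ q) : ∃ J ∈ C, ¬(p ∈ J ↔ q ∈ J) := by
  wlog h : ¬p ≤ q generalizing p q
  · obtain ⟨J, hJ, hs⟩ := this hpq.symm fun h' => hpq (le_antisymm (not_not.1 h) h')
    exact ⟨J, hJ, fun h' => hs h'.symm⟩
  by_contra! hsep
  -- Adjoin `q` to the largest member `J` omitting `p`. If no member separated the two, the result
  -- `K` would be comparable with all members, hence a member itself; but `K` contains `q` and not
  -- `p`.
  obtain ⟨J, ⟨hJC, hpJ⟩, hmax⟩ := Set.Finite.exists_maximalFor id {J | J ∈ C ∧ p ∉ J}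
    (Set.toFinite _) ⟨⊥, C.bot_mem, fun h => h⟩
  have hle : ∀ L ∈ C, p ∉ L → L ≤ J := fun L hL hpL =>
    (C.le_or_le hL hJC).elim id fun h' => hmax ⟨hL, hpL⟩ h'
  set K : LowerSet P := J ⊔ LowerSet.Iic q with hK
  have hpK : p ∉ K := by
    rw [hK, LowerSet.mem_sup_iff, LowerSet.mem_Iic_iff]; tauto
  have hqK : q ∈ K := by
    rw [hK, LowerSet.mem_sup_iff, LowerSet.mem_Iic_iff]; exact Or.inr le_rfl
  have hKC : K ∈ C := by
    have hchain : IsChain (· ≤ ·) (insert K (C : Set (LowerSet P))) := by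
      refine C.chain_le.insert fun L hL _ => ?_
      by_cases hpL : p ∈ L
      · left
        refine sup_le ?_ (LowerSet.Iic_le.2 ((hsep L hL).1 hpL))
        exact (C.le_or_le hJC hL).elim id fun h' => absurd (h' hpL) hpJ
      · exact Or.inr ((hle L hL hpL).trans le_sup_left)
    have := C.max_chain' hchain (Set.subset_insert _ _)
    change K ∈ C.carrier
    rw [this]
    exact Set.mem_insert _ _
  exact hpK ((hsep K hKC).2 hqK)

/-- Let p precede q when some member of the flag contains p and not q. Separation makes this a total
order, and it extends that of `P`. Every member of the flag is an initial segment of it, so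
maximality gives equality. -/
theorem linearExtensionFlag_surjective [Fintype P] (hN : Fintype.card P = N) :
    Function.Surjective (linearExtensionFlag (P := P) hN) := by
  intro C
  let r : P → P → Prop := fun p q => ∃ J ∈ C, p ∈ J ∧ q ∉ J
  have hasymm : ∀ p q, r p q → ¬r q p := by
    rintro p q ⟨J, hJ, hp, hq⟩ ⟨K, hK, hq', hp'⟩
    rcases C.le_or_le hJ hK with h | h
    · exact hp' (h hp)
    · exact hq (h hq')
  have : IsStrictTotalOrder P r :=
    { irrefl := fun p h => hasymm p p h h
      trans := by
        rintro p q s ⟨J, hJ, hp, hq⟩ ⟨K, hK, hq', hs⟩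
        refine ⟨J, hJ, hp, fun hs' => ?_⟩
        rcases C.le_or_le hJ hK with h | h
        · exact hs (h hs')
        · exact hq (h hq')
      trichotomous := by
        intro p q h1 h2
        by_contra hne
        obtain ⟨J, hJ, hs⟩ := C.exists_separating_lowerSet hne
        by_cases hp : p ∈ J
        · exact h1 ⟨J, hJ, hp, fun hq => hs (by tauto)⟩
        · exact h2 ⟨J, hJ, by tauto, hp⟩ }
  obtain ⟨f, hf⟩ := exists_equiv_fin_of_isStrictTotalOrder hN r
  have hmono : StrictMono f := by
    intro p q hpq
    rw [← hf]
    obtain ⟨J, hJ, hs⟩ := C.exists_separating_lowerSet hpq.ne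
    have := fun h => J.lower hpq.le h
    exact ⟨J, hJ, by tauto⟩
  refine ⟨⟨f, hmono⟩, ?_⟩
  refine (SetLike.coe_injective ?_ : C = _).symm
  refine C.max_chain' (linearExtensionFlag hN ⟨f, hmono⟩).chain_le fun J hJ => ?_
  have hJfin : (J : Set P).ncard ≤ N := by
    rw [← hN, ← Nat.card_eq_fintype_card]; exact Set.ncard_le_card _
  have hcl : ∀ p q, p ∈ J → q ∉ J → f p < f q := fun p q hp hq => (hf p q).1 ⟨J, hJ, hp, hq⟩
  have hc := ncard_initialLowerSet ⟨f, hmono⟩ hJfin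
  refine ⟨(J : Set P).ncard, ?_⟩
  by_cases hsub : (J : Set P) ⊆ initialLowerSet ⟨f, hmono⟩ (J : Set P).ncard
  · exact (SetLike.coe_injective (Set.eq_of_subset_of_ncard_le hsub hc.le)).symm
  · obtain ⟨p, hp, hp'⟩ := Set.not_subset.1 hsub
    have h2 : (initialLowerSet ⟨f, hmono⟩ (J : Set P).ncard : Set P) ⊆ J := by
      intro q hq
      by_contra hq'
      have h3 := hcl p q hp hq'
      exact hp' (mem_initialLowerSet.2 (lt_trans (Fin.lt_def.1 h3) hq))
    exact SetLike.coe_injective (Set.eq_of_subset_of_ncard_le h2 hc.ge)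

theorem card_flag_lowerSet [Fintype P] (hN : Fintype.card P = N) :
    Nat.card (Flag (LowerSet P)) = Nat.card {f : P ≃ Fin N // StrictMono f} :=
  (Nat.card_congr (Equiv.ofBijective (linearExtensionFlag hN)
    ⟨linearExtensionFlag_injective hN, linearExtensionFlag_surjective hN⟩)).symm

end LinearExtensions

/-! ### Tableaux as linear extensions of the staircase -/

section Tableaux

variable {n : ℕ}

theorem ShiftedStaircaseSYT.strictMono (T : ShiftedStaircaseSYT n) : StrictMono T.entry := by
  intro c d hcd
  obtain ⟨⟨i, j⟩, hij⟩ := c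
  obtain ⟨⟨k, l⟩, hkl⟩ := d
  have hle : i ≤ k ∧ j ≤ l := hcd.le
  -- The corner (i, l) is a box of the staircase, so one can go along the row and then down the
  -- column.
  have hil : i < l := lt_of_le_of_lt hle.1 hkl
  have h1 : T.entry ⟨(i, j), hij⟩ ≤ T.entry ⟨(i, l), hil⟩ := by
    rcases hle.2.eq_or_lt with rfl | h
    · exact le_rfl
    · exact (T.row_lt ⟨(i, j), hij⟩ ⟨(i, l), hil⟩ rfl h).le
  have h2 : T.entry ⟨(i, l), hil⟩ ≤ T.entry ⟨(k, l), hkl⟩ := by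
    rcases hle.1.eq_or_lt with rfl | h
    · exact le_rfl
    · exact (T.col_lt ⟨(i, l), hil⟩ ⟨(k, l), hkl⟩ rfl h).le
  exact lt_of_le_of_ne (h1.trans h2) fun h => hcd.ne (T.entry.injective h)

/-- Tableaux of shifted staircase shape are the linear extensions of the poset of boxes. -/
def shiftedStaircaseSYTEquiv (n : ℕ) : ShiftedStaircaseSYT n ≃
    {f : StaircaseBox n ≃ Fin (n.choose 2) // StrictMono f} where
  toFun T := ⟨T.entry, T.strictMono⟩
  invFun f :=
    { entry := f.1
      row_lt := fun c d h1 h2 => f.2 (lt_of_le_of_ne ⟨h1.le, h2.le⟩ (by rintro rfl; exact h2.ne rfl))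
      col_lt := fun c d h1 h2 =>
        f.2 (lt_of_le_of_ne ⟨h2.le, h1.le⟩ (by rintro rfl; exact h2.ne rfl)) }
  left_inv _ := rfl
  right_inv _ := rfl

theorem card_staircaseBox (n : ℕ) : Fintype.card (StaircaseBox n) = n.choose 2 := by
  rw [Fintype.card_subtype]
  induction n with
  | zero => simp
  | succ n ih =>
    have : (Finset.univ.filter fun c : Fin (n + 1) × Fin (n + 1) => c.1 < c.2).card =
        ∑ j : Fin (n + 1), (j : ℕ) := by
      rw [Finset.card_filter, ← Finset.univ_product_univ, Finset.sum_product_right]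
      refine Finset.sum_congr rfl fun j _ => ?_
      rw [← Finset.card_filter]
      have : (Finset.univ.filter fun i => i < j) = Finset.Iio j := by ext; simp
      rw [this, Fin.card_Iio]
    rw [this, Fin.sum_univ_eq_sum_range (fun i => i), Finset.sum_range_id, Nat.choose_two_right]

theorem card_flag_lowerSet_staircaseBox (n : ℕ) :
    Nat.card (Flag (LowerSet (StaircaseBox n))) = Nat.card (ShiftedStaircaseSYT n) := by
  rw [card_flag_lowerSet (card_staircaseBox n), Nat.card_congr (shiftedStaircaseSYTEquiv n)]

end Tableaux

/-! ### Flags of a union of two nearly incomparable parts -/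

section FlagDecomposition

variable {α : Type*} [PartialOrder α]

theorem Flag.mem_of_forall_le_or_le (C : Flag α) {a : α} (h : ∀ c ∈ C, a ≤ c ∨ c ≤ a) :
    a ∈ C := by
  have hchain : IsChain (· ≤ ·) (insert a (C : Set α)) :=
    C.chain_le.insert fun c hc _ => h c hc
  change a ∈ C.carrier
  rw [C.max_chain' hchain (Set.subset_insert _ _)]
  exact Set.mem_insert _ _

variable {p q : α → Prop}

/-- If `p` covers all elements comparable with some element of a flag `C` of `{x // p x}`,
then `C` is a flag of the whole order. -/
def Flag.ofSubtype (C : Flag {x // p x}) (h : ∃ c ∈ C, ∀ x, ¬p x → ¬(c.1 ≤ x ∨ x ≤ c.1)) :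
    Flag α where
  carrier := Subtype.val '' (C : Set {x // p x})
  Chain' := by
    rintro _ ⟨a, ha, rfl⟩ _ ⟨b, hb, rfl⟩ -
    exact C.le_or_le ha hb
  max_chain' := by
    intro s hs hsub
    obtain ⟨c, hc, hcx⟩ := h
    refine hsub.antisymm fun x hx => ?_
    have hpx : p x := by
      by_contra hpx
      exact hcx x hpx (hs.total (hsub ⟨c, hc, rfl⟩) hx)
    exact ⟨⟨x, hpx⟩, C.mem_of_forall_le_or_le fun d hd => hs.total hx (hsub ⟨d, hd, rfl⟩), rfl⟩

/-- A flag all of whose elements satisfy `p` is a flag of `{x // p x}`. -/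
def Flag.toSubtype (C : Flag α) (h : ∀ c ∈ C, p c) : Flag {x // p x} where
  carrier := {x | x.1 ∈ C}
  Chain' := fun _ ha _ hb _ => C.le_or_le ha hb
  max_chain' := by
    intro s hs hsub
    refine hsub.antisymm fun x hx => ?_
    exact C.mem_of_forall_le_or_le fun c hc => hs.total hx (hsub (a := ⟨c, h c hc⟩) hc)

/-- The hypothesis keeps a flag of the part maximal in the whole order: an element outside the part
that enlarged it would be comparable with all its members. -/
theorem Flag.card_flag_subtype
    (h : ∀ C : Flag {x // p x}, ∃ c ∈ C, ∀ x, ¬p x → ¬(c.1 ≤ x ∨ x ≤ c.1)) :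
    Nat.card {C : Flag α // ∀ c ∈ C, p c} = Nat.card (Flag {x // p x}) := by
  refine Nat.card_congr
    { toFun := fun C => C.1.toSubtype C.2
      invFun := fun C => ⟨C.ofSubtype (h C), ?_⟩
      left_inv := ?_
      right_inv := ?_ }
  · rintro _ ⟨a, -, rfl⟩
    exact a.2
  · intro C
    apply Subtype.ext
    apply SetLike.coe_injective
    ext x
    constructor
    · rintro ⟨a, ha, rfl⟩
      exact ha
    · exact fun hx => ⟨⟨x, C.2 x hx⟩, hx, rfl⟩
  · intro C
    apply SetLike.coe_injective
    ext x
    constructor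
    · rintro ⟨a, ha, hax⟩
      exact Subtype.ext hax ▸ ha
    · exact fun hx => ⟨x, hx, rfl⟩

/-- Under these hypotheses every flag of `{x // p x}` has an element violating `q`. -/
theorem Flag.exists_not_of_subtype
    (hcomp : ∀ x y, p x → q x → x ≤ y ∨ y ≤ x) (hex : ∃ a, p a ∧ ¬q a)
    (C : Flag {x // p x}) : ∃ c ∈ C, ¬q c.1 := by
  by_contra! hc
  obtain ⟨a, hpa, hqa⟩ := hex
  -- A flag inside `q` would have all its members comparable with `a`, so it would contain `a`.
  exact hqa (hc ⟨a, hpa⟩ (C.mem_of_forall_le_or_le fun c hcC =>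
    (hcomp c.1 a c.2 (hc c hcC)).symm))

/-- Flags of an order that is the union of two parts which are incomparable except for elements
in both parts, the latter being comparable with everything. -/
theorem card_flag_eq_add [Finite α] (hpq : ∀ x, p x ∨ q x)
    (hcomp : ∀ x y, p x → q x → x ≤ y ∨ y ≤ x)
    (hinc : ∀ x y, p x → ¬q x → q y → ¬p y → ¬(x ≤ y ∨ y ≤ x))
    (hexp : ∃ a, p a ∧ ¬q a) (hexq : ∃ a, q a ∧ ¬p a) :
    Nat.card (Flag α) = Nat.card (Flag {x // p x}) + Nat.card (Flag {x // q x}) := by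
  classical
  have hp : ∀ C : Flag {x // p x}, ∃ c ∈ C, ∀ x, ¬p x → ¬(c.1 ≤ x ∨ x ≤ c.1) := fun C => by
    obtain ⟨c, hc, hqc⟩ := C.exists_not_of_subtype hcomp hexp
    exact ⟨c, hc, fun x hx => hinc _ _ c.2 hqc ((hpq x).resolve_left hx) hx⟩
  have hq : ∀ C : Flag {x // q x}, ∃ c ∈ C, ∀ x, ¬q x → ¬(c.1 ≤ x ∨ x ≤ c.1) := fun C => by
    obtain ⟨c, hc, hpc⟩ := C.exists_not_of_subtype (fun x y h1 h2 => hcomp x y h2 h1) hexq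
    exact ⟨c, hc, fun x hx h' => hinc _ _ ((hpq x).resolve_right hx) hx c.2 hpc h'.symm⟩
  have hsplit : ∀ C : Flag α, ¬(∀ c ∈ C, p c) ↔ ∀ c ∈ C, q c := by
    intro C
    constructor
    · intro h c hc
      push Not at h
      obtain ⟨d, hd, hpd⟩ := h
      by_contra hqc
      exact hinc c d ((hpq c).resolve_right hqc) hqc ((hpq d).resolve_left hpd) hpd
        (C.le_or_le hc hd)
    · intro h h'
      obtain ⟨a, ha, hqa⟩ := hexp
      exact hqa (h a (C.mem_of_forall_le_or_le fun c hc => (hcomp c a (h' c hc) (h c hc)).symm))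
  have : Finite (Flag α) := Finite.of_injective (fun C : Flag α => (C : Set α)) SetLike.coe_injective
  rw [← Flag.card_flag_subtype hp, ← Flag.card_flag_subtype hq,
    ← Nat.card_congr (Equiv.sumCompl fun C : Flag α => ∀ c ∈ C, p c), Nat.card_sum]
  congr 1
  exact Nat.card_congr (Equiv.subtypeEquivRight hsplit)

end FlagDecomposition

/-! ### Unimodal permutations and lower sets of boxes -/

section Unimodal

variable {n : ℕ}

/-- Every nonempty prefix of the word of `π` forms an interval. -/
def IsPrefixUnimodal (π : Equiv.Perm (Fin n)) : Prop :=
  ∀ k : Fin n, IsLetterInterval (π '' Set.Iic k)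

/-- Every nonempty suffix of the word of `π` forms an interval. -/
def IsSuffixUnimodal (π : Equiv.Perm (Fin n)) : Prop :=
  ∀ k : Fin n, IsLetterInterval (π '' Set.Ici k)

theorem isLetterInterval_iff {A : Set (Fin n)} :
    IsLetterInterval A ↔ A.Nonempty ∧ ∀ x y z, x < y → y < z → x ∈ A → z ∈ A → y ∈ A := by
  constructor
  · rintro ⟨a, b, hab, rfl⟩
    exact ⟨⟨a, le_rfl, hab⟩, fun x y z hxy hyz hx hz => ⟨hx.1.trans hxy.le, hyz.le.trans hz.2⟩⟩
  · rintro ⟨hne, h⟩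
    obtain ⟨a, ha⟩ := A.toFinite.exists_minimal hne
    obtain ⟨b, hb⟩ := A.toFinite.exists_maximal hne
    have ha' : ∀ x ∈ A, a ≤ x := fun x hx => (le_total a x).elim id fun h' => ha.2 hx h'
    have hb' : ∀ x ∈ A, x ≤ b := fun x hx => (le_total x b).elim id fun h' => hb.2 hx h'
    refine ⟨a, b, ha' b hb.1, Set.Subset.antisymm (fun x hx => ⟨ha' x hx, hb' x hx⟩) ?_⟩
    rintro x ⟨hax, hxb⟩
    rcases hax.eq_or_lt with rfl | hax
    · exact ha.1
    rcases hxb.eq_or_lt with rfl | hxb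
    · exact hb.1
    exact h a x b hax hxb ha.1 hb.1

/-- The prefix ending at the later of x and z contains both, hence y: the middle letter is never the
last of the three. -/
theorem isPrefixUnimodal_iff {π : Equiv.Perm (Fin n)} :
    IsPrefixUnimodal π ↔ ∀ x y z, x < y → y < z → π⁻¹ y < π⁻¹ x ∨ π⁻¹ y < π⁻¹ z := by
  have hmem : ∀ k x, x ∈ π '' Set.Iic k ↔ π⁻¹ x ≤ k := fun k x => by
    rw [Equiv.image_eq_preimage_symm]; rfl
  simp only [IsPrefixUnimodal, isLetterInterval_iff, hmem]
  constructor
  · intro h x y z hxy hyz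
    have hx : π⁻¹ y ≠ π⁻¹ x := fun h' => hxy.ne' (π⁻¹.injective h')
    have hz : π⁻¹ y ≠ π⁻¹ z := fun h' => hyz.ne (π⁻¹.injective h')
    rcases le_max_iff.1 ((h (max (π⁻¹ x) (π⁻¹ z))).2 x y z hxy hyz (le_max_left _ _)
      (le_max_right _ _)) with h1 | h1
    · exact Or.inl (lt_of_le_of_ne h1 hx)
    · exact Or.inr (lt_of_le_of_ne h1 hz)
  · refine fun h k => ⟨⟨π k, by simp⟩, fun x y z hxy hyz hx hz => ?_⟩
    rcases h x y z hxy hyz with h1 | h1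
    · exact h1.le.trans hx
    · exact h1.le.trans hz

theorem isSuffixUnimodal_iff {π : Equiv.Perm (Fin n)} :
    IsSuffixUnimodal π ↔ ∀ x y z, x < y → y < z → π⁻¹ x < π⁻¹ y ∨ π⁻¹ z < π⁻¹ y := by
  have hmem : ∀ k x, x ∈ π '' Set.Ici k ↔ k ≤ π⁻¹ x := fun k x => by
    rw [Equiv.image_eq_preimage_symm]; rfl
  simp only [IsSuffixUnimodal, isLetterInterval_iff, hmem]
  constructor
  · intro h x y z hxy hyz
    have hx : π⁻¹ x ≠ π⁻¹ y := fun h' => hxy.ne (π⁻¹.injective h')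
    have hz : π⁻¹ z ≠ π⁻¹ y := fun h' => hyz.ne' (π⁻¹.injective h')
    rcases min_le_iff.1 ((h (min (π⁻¹ x) (π⁻¹ z))).2 x y z hxy hyz (min_le_left _ _)
      (min_le_right _ _)) with h1 | h1
    · exact Or.inl (lt_of_le_of_ne h1 hx)
    · exact Or.inr (lt_of_le_of_ne h1 hz)
  · refine fun h k => ⟨⟨π k, by simp⟩, fun x y z hxy hyz hx hz => ?_⟩
    rcases h x y z hxy hyz with h1 | h1
    · exact hx.trans h1.le
    · exact hz.trans h1.le

theorem inversionBoxes_injective {π τ : Equiv.Perm (Fin n)}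
    (h : inversionBoxes π = inversionBoxes τ) : π = τ := by
  exact le_antisymm (α := WeakPerm n) (weakPerm_le_iff_inversionBoxes.2 h.le)
    (weakPerm_le_iff_inversionBoxes.2 h.ge)

/-- Shrink one coordinate at a time. With y before x and x' < x < y, the letter x is not last, so it
precedes x', and so does y. The second coordinate is treated likewise. -/
theorem IsPrefixUnimodal.isLowerSet {π : Equiv.Perm (Fin n)} (h : IsPrefixUnimodal π) :
    IsLowerSet (inversionBoxes π) := by
  rw [isPrefixUnimodal_iff] at h
  rintro ⟨⟨x, y⟩, hxy⟩ ⟨⟨x', y'⟩, hxy'⟩ hle hc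
  have hx : x' ≤ x := hle.1
  have hy : y' ≤ y := hle.2
  rw [mem_inversionBoxes] at hc ⊢
  dsimp only at *
  have h1 : π⁻¹ y < π⁻¹ x' := by
    rcases hx.eq_or_lt with rfl | hx
    · exact hc
    · rcases h x' x y hx hxy with h' | h'
      · exact hc.trans h'
      · exact absurd h' hc.not_gt
  rcases hy.eq_or_lt with rfl | hy
  · exact h1
  · rcases h x' y' y hxy' hy with h' | h'
    · exact h'
    · exact h'.trans h1

/-- Every lower set of boxes is the set of inversions of a prefix unimodal permutation. -/
theorem exists_inversionBoxes_eq (I : LowerSet (StaircaseBox n)) :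
    ∃ π : Equiv.Perm (Fin n), IsPrefixUnimodal π ∧ inversionBoxes π = I := by
  -- The intended order of letters in the word: reversed for the pairs in `I`, natural for the
  -- others. Its enumeration `f` gives positions, so the permutation is `f⁻¹`.
  let r : Fin n → Fin n → Prop := fun x y =>
    (∃ h : x < y, (⟨(x, y), h⟩ : StaircaseBox n) ∉ I) ∨
    (∃ h : y < x, (⟨(y, x), h⟩ : StaircaseBox n) ∈ I)
  have hlow : ∀ {x y x' y' : Fin n} (h : x < y) (h' : x' < y'), x' ≤ x → y' ≤ y →
      (⟨(x, y), h⟩ : StaircaseBox n) ∈ I → (⟨(x', y'), h'⟩ : StaircaseBox n) ∈ I :=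
    fun h h' hx hy hm => I.lower (show (⟨(_, _), h'⟩ : StaircaseBox n) ≤ ⟨(_, _), h⟩ from ⟨hx, hy⟩) hm
  have : IsStrictTotalOrder (Fin n) r :=
    { irrefl := by
        rintro x (⟨h, -⟩ | ⟨h, -⟩) <;> exact lt_irrefl _ h
      trans := by
        rintro x y z (⟨h1, h2⟩ | ⟨h1, h2⟩) (⟨h3, h4⟩ | ⟨h3, h4⟩)
        · exact Or.inl ⟨h1.trans h3, fun h => h2 (hlow _ _ le_rfl h3.le h)⟩
        · rcases lt_trichotomy x z with h | rfl | h
          · exact absurd (hlow _ _ h.le le_rfl h4) h2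
          · exact absurd h4 h2
          · exact Or.inr ⟨h, hlow h3 h le_rfl h1.le h4⟩
        · rcases lt_trichotomy x z with h | rfl | h
          · exact Or.inl ⟨h, fun h' => h4 (hlow h h3 (by order) le_rfl h')⟩
          · exact absurd h2 h4
          · exact absurd (hlow h1 h3 le_rfl h.le h2) h4
        · exact Or.inr ⟨h3.trans h1, hlow h1 _ h3.le le_rfl h2⟩
      trichotomous := by
        intro x y h1 h2
        by_contra hne
        rcases lt_or_gt_of_ne hne with h | h
        · by_cases hm : (⟨(x, y), h⟩ : StaircaseBox n) ∈ I
          · exact h2 (Or.inr ⟨h, hm⟩)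
          · exact h1 (Or.inl ⟨h, hm⟩)
        · by_cases hm : (⟨(y, x), h⟩ : StaircaseBox n) ∈ I
          · exact h1 (Or.inr ⟨h, hm⟩)
          · exact h2 (Or.inl ⟨h, hm⟩) }
  obtain ⟨f, hf⟩ := exists_equiv_fin_of_isStrictTotalOrder (Fintype.card_fin n) r
  have hinv : ∀ x, (f⁻¹ : Equiv.Perm (Fin n))⁻¹ x = f x := fun x => by rw [inv_inv]
  refine ⟨(f : Equiv.Perm (Fin n))⁻¹, ?_, ?_⟩
  · rw [isPrefixUnimodal_iff]
    intro x y z hxy hyz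
    rw [hinv, hinv, hinv, ← hf, ← hf]
    -- Since (x, y) ≤ (y, z), either (x, y) is in `I` and y precedes x, or (y, z) is not and y
    -- precedes z.
    by_cases hm : (⟨(x, y), hxy⟩ : StaircaseBox n) ∈ I
    · exact Or.inl (Or.inr ⟨hxy, hm⟩)
    · exact Or.inr (Or.inl ⟨hyz, fun h' => hm (hlow hyz hxy hxy.le hyz.le h')⟩)
  · ext ⟨⟨x, y⟩, hxy⟩
    rw [mem_inversionBoxes]
    dsimp only
    rw [hinv, hinv, ← hf]
    constructor
    · rintro (⟨h, -⟩ | ⟨_, h⟩)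
      · exact absurd h hxy.not_gt
      · exact h
    · exact fun h => Or.inr ⟨hxy, h⟩

/-- The prefix unimodal permutations form a copy of the lattice of lower sets of boxes. -/
noncomputable def prefixUnimodalOrderIso (n : ℕ) :
    {π : WeakPerm n // IsPrefixUnimodal π.toPerm} ≃o LowerSet (StaircaseBox n) where
  toEquiv := Equiv.ofBijective (fun π => ⟨inversionBoxes π.1.toPerm, π.2.isLowerSet⟩)
    ⟨fun _ _ h => Subtype.ext (inversionBoxes_injective (congrArg LowerSet.carrier h)), fun I => by
      obtain ⟨π, hπ, hI⟩ := exists_inversionBoxes_eq I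
      exact ⟨⟨π, hπ⟩, SetLike.coe_injective hI⟩⟩
  map_rel_iff' := fun {_ _} => weakPerm_le_iff_inversionBoxes.symm

/-- Conjugation by the longest permutation. -/
def revConj (π : Equiv.Perm (Fin n)) : Equiv.Perm (Fin n) := Fin.revPerm * π * Fin.revPerm

theorem revConj_inv_apply (π : Equiv.Perm (Fin n)) (x : Fin n) :
    (revConj π)⁻¹ x = Fin.rev (π⁻¹ (Fin.rev x)) := by
  rw [Equiv.Perm.inv_eq_iff_eq]
  simp [revConj]

theorem revConj_revConj (π : Equiv.Perm (Fin n)) : revConj (revConj π) = π := by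
  ext x; simp [revConj]

/-- Reversing positions exchanges prefixes and suffixes; reversing letters preserves intervals. -/
theorem isPrefixUnimodal_revConj_iff {π : Equiv.Perm (Fin n)} :
    IsPrefixUnimodal (revConj π) ↔ IsSuffixUnimodal π := by
  rw [isPrefixUnimodal_iff, isSuffixUnimodal_iff]
  simp only [revConj_inv_apply, Fin.rev_lt_rev]
  constructor
  · intro h x y z hxy hyz
    have := h z.rev y.rev x.rev (Fin.rev_lt_rev.2 hyz) (Fin.rev_lt_rev.2 hxy)
    simp only [Fin.rev_rev] at this
    exact this.symm
  · intro h x y z hxy hyz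
    exact (h z.rev y.rev x.rev (Fin.rev_lt_rev.2 hyz) (Fin.rev_lt_rev.2 hxy)).symm

theorem inversionBoxes_revConj_subset {π τ : Equiv.Perm (Fin n)}
    (h : inversionBoxes π ⊆ inversionBoxes τ) :
    inversionBoxes (revConj π) ⊆ inversionBoxes (revConj τ) := by
  rintro ⟨⟨x, y⟩, hxy⟩ hc
  rw [mem_inversionBoxes] at hc ⊢
  simp only [revConj_inv_apply, Fin.rev_lt_rev] at hc ⊢
  exact @h ⟨(y.rev, x.rev), Fin.rev_lt_rev.2 hxy⟩ hc

theorem revConj_le_iff {π τ : WeakPerm n} :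
    @LE.le (WeakPerm n) _ (revConj π.toPerm) (revConj τ.toPerm) ↔ π ≤ τ := by
  refine weakPerm_le_iff_inversionBoxes.trans
    (Iff.trans ⟨fun h => ?_, inversionBoxes_revConj_subset⟩ weakPerm_le_iff_inversionBoxes.symm)
  have := inversionBoxes_revConj_subset h
  change inversionBoxes (revConj (revConj _)) ⊆ inversionBoxes (revConj (revConj _)) at this
  rwa [revConj_revConj, revConj_revConj] at this

/-- Conjugation by the longest permutation exchanges the two kinds of unimodal permutations. -/
def suffixPrefixOrderIso (n : ℕ) :
    {π : WeakPerm n // IsSuffixUnimodal π.toPerm} ≃o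
      {π : WeakPerm n // IsPrefixUnimodal π.toPerm} where
  toFun π := ⟨revConj π.1.toPerm, isPrefixUnimodal_revConj_iff.2 π.2⟩
  invFun π := ⟨revConj π.1.toPerm, isPrefixUnimodal_revConj_iff.1 (by
    change IsPrefixUnimodal (revConj (revConj _)); rw [revConj_revConj]; exact π.2)⟩
  left_inv π := Subtype.ext (revConj_revConj _)
  right_inv π := Subtype.ext (revConj_revConj _)
  map_rel_iff' := fun {_ _} => revConj_le_iff

/-- One inversion forces the least box: letter 1 precedes letter 0. As the middle letter never comes
first, every y > 1 precedes 1, so all letters precede 0; the triples 0 < x < y then invert every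
pair. -/
theorem IsPrefixUnimodal.inversionBoxes_eq_empty_or_univ {π : Equiv.Perm (Fin n)}
    (hp : IsPrefixUnimodal π) (hs : IsSuffixUnimodal π) :
    inversionBoxes π = ∅ ∨ inversionBoxes π = Set.univ := by
  have hlow := hp.isLowerSet
  rw [isPrefixUnimodal_iff] at hp
  rw [isSuffixUnimodal_iff] at hs
  by_contra! h
  obtain ⟨⟨⟨⟨x, y⟩, hxy⟩, h1⟩, h2⟩ := h
  have hn : 1 < n := by have := Fin.lt_def.1 hxy; omega
  refine h2 (Set.eq_univ_of_forall ?_)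
  let a : Fin n := ⟨0, by omega⟩
  let b : Fin n := ⟨1, hn⟩
  have hab : a < b := Fin.lt_def.2 Nat.zero_lt_one
  have hba : π⁻¹ b < π⁻¹ a := by
    have hle : (⟨(a, b), hab⟩ : StaircaseBox n) ≤ ⟨(x, y), hxy⟩ :=
      ⟨Fin.le_def.2 (Nat.zero_le _),
        Fin.le_def.2 (Nat.succ_le_of_lt (lt_of_le_of_lt (Nat.zero_le _) (Fin.lt_def.1 hxy)))⟩
    exact hlow hle h1
  have hay : ∀ y, a < y → π⁻¹ y < π⁻¹ a := by
    intro y hy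
    rcases (show b ≤ y from Fin.le_def.2 (Nat.succ_le_of_lt (Fin.lt_def.1 hy))).eq_or_lt with
      rfl | hby
    · exact hba
    · rcases hs a b y hab hby with h | h
      · exact absurd h hba.not_gt
      · exact h.trans hba
  rintro ⟨⟨x, y⟩, hxy⟩
  rw [mem_inversionBoxes]
  rcases (show a ≤ x from Fin.le_def.2 (Nat.zero_le _)).eq_or_lt with hax | hax
  · exact hax ▸ hay y (hax ▸ hxy)
  · rcases hs a x y hax hxy with h | h
    · exact absurd h (hay x hax).not_gt
    · exact h

theorem isSuffixUnimodal_of_inversionBoxes_eq_empty {π : Equiv.Perm (Fin n)}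
    (h : inversionBoxes π = ∅) : IsSuffixUnimodal π := by
  rw [isSuffixUnimodal_iff]
  intro x y z hxy hyz
  have h1 : (⟨(x, y), hxy⟩ : StaircaseBox n) ∉ inversionBoxes π := by simp [h]
  exact Or.inl (lt_of_le_of_ne (not_lt.1 h1) fun h' => hxy.ne (π⁻¹.injective h'))

theorem isSuffixUnimodal_of_inversionBoxes_eq_univ {π : Equiv.Perm (Fin n)}
    (h : inversionBoxes π = Set.univ) : IsSuffixUnimodal π := by
  rw [isSuffixUnimodal_iff]
  intro x y z hxy hyz
  have h1 : (⟨(y, z), hyz⟩ : StaircaseBox n) ∈ inversionBoxes π := by simp [h]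
  exact Or.inr h1

/-- A prefix unimodal permutation that is not suffix unimodal inverts the two smallest letters,
and does not invert the two largest ones. -/
theorem IsPrefixUnimodal.mem_and_notMem {π : Equiv.Perm (Fin n)} (hp : IsPrefixUnimodal π)
    (hs : ¬IsSuffixUnimodal π) {c d : StaircaseBox n} (hc : IsBot c) (hd : IsTop d) :
    c ∈ inversionBoxes π ∧ d ∉ inversionBoxes π := by
  constructor
  · by_contra h
    exact hs (isSuffixUnimodal_of_inversionBoxes_eq_empty
      (Set.eq_empty_of_forall_notMem fun e he => h (hp.isLowerSet (hc e) he)))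
  · intro h
    exact hs (isSuffixUnimodal_of_inversionBoxes_eq_univ
      (Set.eq_univ_of_forall fun e => hp.isLowerSet (hd e) h))

theorem exists_isBot_isTop_staircaseBox (hn : 1 < n) : ∃ c d : StaircaseBox n,
    IsBot c ∧ IsTop d ∧ d.1.2 = c.1.1.rev ∧ d.1.1 = c.1.2.rev := by
  refine ⟨⟨(⟨0, by omega⟩, ⟨1, hn⟩), Fin.lt_def.2 Nat.zero_lt_one⟩,
    ⟨(⟨n - 2, by omega⟩, ⟨n - 1, by omega⟩), Fin.lt_def.2 (by simp; omega)⟩, ?_, ?_, ?_, ?_⟩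
  · rintro ⟨⟨x, y⟩, hxy⟩
    have : (x : ℕ) < y := hxy
    exact ⟨Fin.le_def.2 (Nat.zero_le _), Fin.le_def.2 (show 1 ≤ (y : ℕ) by omega)⟩
  · rintro ⟨⟨x, y⟩, hxy⟩
    have : (x : ℕ) < y := hxy
    exact ⟨Fin.le_def.2 (show (x : ℕ) ≤ n - 2 by omega),
      Fin.le_def.2 (show (y : ℕ) ≤ n - 1 by omega)⟩
  · ext; simp
  · ext; simp

theorem exists_isPrefixUnimodal_not_isSuffixUnimodal (hn : 2 < n) :
    ∃ π : Equiv.Perm (Fin n), IsPrefixUnimodal π ∧ ¬IsSuffixUnimodal π := by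
  let a : Fin n := ⟨0, by omega⟩
  let b : Fin n := ⟨1, by omega⟩
  let c : Fin n := ⟨2, hn⟩
  have hab : a < b := Fin.lt_def.2 Nat.zero_lt_one
  have hbc : b < c := Fin.lt_def.2 Nat.one_lt_two
  -- The word 1 0 2 … : here letter 1 precedes both 0 and 2, which the suffix condition forbids.
  obtain ⟨π, hp, hI⟩ := exists_inversionBoxes_eq (LowerSet.Iic (⟨(a, b), hab⟩ : StaircaseBox n))
  refine ⟨π, hp, fun hs => ?_⟩
  have h1 : (⟨(a, b), hab⟩ : StaircaseBox n) ∈ inversionBoxes π := by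
    rw [hI]; exact LowerSet.mem_Iic_iff.2 le_rfl
  have h2 : (⟨(b, c), hbc⟩ : StaircaseBox n) ∉ inversionBoxes π := by
    rw [hI]; exact fun h => hab.not_ge (LowerSet.mem_Iic_iff.1 h).1
  rcases isSuffixUnimodal_iff.1 hs a b c hab hbc with h | h
  · exact absurd h (not_lt.2 (le_of_lt h1))
  · exact h2 h

/-- The elements of `Weak(U_n)` with a property of unimodal permutations. -/
def weakUnimodalSubtypeOrderIso (p : Equiv.Perm (Fin n) → Prop) (hp : ∀ π, p π → IsUnimodal π) :
    {π : WeakUnimodal n // p π.1.toPerm} ≃o {π : WeakPerm n // p π.toPerm} where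
  toFun π := ⟨π.1.1, π.2⟩
  invFun π := ⟨⟨π.1, hp _ π.2⟩, π.2⟩
  left_inv _ := rfl
  right_inv _ := rfl
  map_rel_iff' := Iff.rfl

theorem card_flag_weakUnimodal (hn : 2 < n) :
    Nat.card (Flag (WeakUnimodal n)) = 2 * Nat.card (Flag (LowerSet (StaircaseBox n))) := by
  obtain ⟨c, d, hc, hd, hdc, hcd⟩ := exists_isBot_isTop_staircaseBox (by omega : 1 < n)
  obtain ⟨ρ, hρp, hρs⟩ := exists_isPrefixUnimodal_not_isSuffixUnimodal hn
  have hρs' : ¬IsPrefixUnimodal (revConj ρ) := by rwa [isPrefixUnimodal_revConj_iff]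
  have hρp' : IsSuffixUnimodal (revConj ρ) := by
    rwa [← isPrefixUnimodal_revConj_iff, revConj_revConj]
  -- Conjugation exchanges the least box `c` and the greatest box `d`, so the prefix statement turns
  -- into its opposite.
  have hsuf : ∀ π : Equiv.Perm (Fin n), IsSuffixUnimodal π → ¬IsPrefixUnimodal π →
      c ∉ inversionBoxes π ∧ d ∈ inversionBoxes π := by
    intro π hs hp
    have h := (isPrefixUnimodal_revConj_iff.2 hs).mem_and_notMem
      (by rwa [← isPrefixUnimodal_revConj_iff, revConj_revConj]) hc hd
    simp only [mem_inversionBoxes, revConj_inv_apply, Fin.rev_lt_rev, hdc, hcd,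
      Fin.rev_rev] at h ⊢
    exact h.symm
  have hfin : Finite (WeakUnimodal n) :=
    inferInstanceAs (Finite {π : Equiv.Perm (Fin n) // IsUnimodal π})
  rw [card_flag_eq_add (p := fun π : WeakUnimodal n => IsPrefixUnimodal π.1.toPerm)
      (q := fun π : WeakUnimodal n => IsSuffixUnimodal π.1.toPerm) (fun π => π.2) ?_ ?_
      ⟨⟨ρ, Or.inl hρp⟩, hρp, hρs⟩ ⟨⟨revConj ρ, Or.inr hρp'⟩, hρp', hρs'⟩,
    Nat.card_congr (Flag.map ((weakUnimodalSubtypeOrderIso IsPrefixUnimodal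
      fun _ => Or.inl).trans (prefixUnimodalOrderIso n))),
    Nat.card_congr (Flag.map ((weakUnimodalSubtypeOrderIso IsSuffixUnimodal
      fun _ => Or.inr).trans ((suffixPrefixOrderIso n).trans (prefixUnimodalOrderIso n)))),
    two_mul]
  · intro π τ hp hs
    rcases hp.inversionBoxes_eq_empty_or_univ hs with h | h
    · exact Or.inl (weakPerm_le_iff_inversionBoxes.2 (h ▸ Set.empty_subset _))
    · exact Or.inr (weakPerm_le_iff_inversionBoxes.2 (h ▸ Set.subset_univ _))
  · intro π τ hp hs hs' hp' h
    obtain ⟨h1, h2⟩ := hp.mem_and_notMem hs hc hd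
    obtain ⟨h3, h4⟩ := hsuf _ hs' hp'
    rcases h with h | h
    · exact h3 (weakPerm_le_iff_inversionBoxes.1 h h1)
    · exact h2 (weakPerm_le_iff_inversionBoxes.1 h h4)

end Unimodal

/-! ### The weight of a shifted shape and its recursion -/

section Weight

-- The polynomial ∏(X - v_j) - ∏(X - u_j) has degree less than |Q|. Its coefficient at |Q| - 1 is Σu
-- - Σv, and Lagrange interpolation at the nodes u, where the second product vanishes, gives the
-- left side.
open Polynomial in
theorem sum_prod_sub_div_prod_sub {ι F : Type*} [DecidableEq ι] [Field F] (Q : Finset ι)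
    (u v : ι → F) (hu : Set.InjOn u Q) :
    ∑ i ∈ Q, (∏ j ∈ Q, (u i - v j)) / ∏ j ∈ Q.erase i, (u i - u j) =
      ∑ i ∈ Q, u i - ∑ i ∈ Q, v i := by
  rcases Q.eq_empty_or_nonempty with rfl | hQ
  · simp
  have hdeg : (∏ j ∈ Q, (X - C (v j)) - ∏ j ∈ Q, (X - C (u j)) : F[X]).degree < Q.card := by
    have hd : ∀ w : ι → F, (∏ j ∈ Q, (X - C (w j)) : F[X]).degree = Q.card := fun w => by
      simp [degree_prod]
    have hm : ∀ w : ι → F, (∏ j ∈ Q, (X - C (w j)) : F[X]).leadingCoeff = 1 := fun w =>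
      (monic_prod_of_monic _ _ fun j _ => monic_X_sub_C _).leadingCoeff
    have hne : (∏ j ∈ Q, (X - C (v j)) : F[X]) ≠ 0 :=
      (monic_prod_of_monic _ _ fun j _ => monic_X_sub_C _).ne_zero
    exact (degree_sub_lt_left (by rw [hd, hd]) hne (by rw [hm, hm])).trans_eq (hd v)
  have h := Lagrange.coeff_eq_sum hu hdeg
  rw [coeff_sub, prod_X_sub_C_coeff_card_pred _ _ hQ.card_pos,
    prod_X_sub_C_coeff_card_pred _ _ hQ.card_pos] at h
  rw [← neg_sub_neg, h]
  refine Finset.sum_congr rfl fun i hi => ?_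
  simp only [eval_sub, eval_prod, eval_X, eval_C]
  rw [Finset.prod_eq_zero (f := fun j => u i - u j) hi (sub_self (u i)), sub_zero]

/-- The factor by which the contribution of two parts `a`, `b` of a shape changes when `a`
decreases by one. -/
def partRatio (a b : ℚ) : ℚ := (a + b) * (a - b - 1) / ((a - b) * (a + b - 1))

/-- Interpolate with u = l(l - 1) and v = l(l + 1): for a = l_i, b = l_j the quotients (u_i -
v_j)/(u_i - u_j) are the ratios `partRatio a b`, and the unpaired factor is u_i - v_i = -2 l_i. -/
theorem sum_mul_prod_partRatio {ι : Type*} [DecidableEq ι] (Q : Finset ι) (l : ι → ℕ)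
    (hpos : ∀ i ∈ Q, 0 < l i) (hinj : Set.InjOn l Q) :
    ∑ i ∈ Q, (l i : ℚ) * ∏ j ∈ Q.erase i, partRatio (l i) (l j) = ∑ i ∈ Q, (l i : ℚ) := by
  have hu : Set.InjOn (fun i => (l i : ℚ) * (l i - 1)) Q := by
    intro i hi j hj hij
    have h1 : (1 : ℚ) ≤ l i := by exact_mod_cast hpos i hi
    have h2 : (1 : ℚ) ≤ l j := by exact_mod_cast hpos j hj
    have h3 : ((l i : ℚ) - l j) * (l i + l j - 1) = 0 := by
      simp only at hij; linear_combination hij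
    rcases mul_eq_zero.1 h3 with h | h
    · exact hinj hi hj (by exact_mod_cast sub_eq_zero.1 h)
    · linarith
  have h := sum_prod_sub_div_prod_sub Q _ (fun i => (l i : ℚ) * (l i + 1)) hu
  have h1 : ∀ i ∈ Q, (∏ j ∈ Q, ((l i : ℚ) * (l i - 1) - l j * (l j + 1))) /
      ∏ j ∈ Q.erase i, ((l i : ℚ) * (l i - 1) - l j * (l j - 1)) =
      -2 * (l i * ∏ j ∈ Q.erase i, partRatio (l i) (l j)) := by
    intro i hi
    rw [← Finset.mul_prod_erase Q _ hi, mul_div_assoc, ← Finset.prod_div_distrib]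
    rw [show (l i : ℚ) * (l i - 1) - l i * (l i + 1) = -2 * l i by ring, mul_assoc]
    congr 2
    refine Finset.prod_congr rfl fun j _ => ?_
    rw [partRatio]
    congr 1 <;> ring
  rw [Finset.sum_congr rfl h1, ← Finset.mul_sum, ← Finset.sum_sub_distrib] at h
  have h2 : ∑ i ∈ Q, ((l i : ℚ) * (l i - 1) - l i * (l i + 1)) = -2 * ∑ i ∈ Q, (l i : ℚ) := by
    rw [Finset.mul_sum]
    exact Finset.sum_congr rfl fun i _ => by ring
  rw [h2] at h
  linarith

/-- The contribution of two rows of lengths `a > b` to the number of standard fillings. -/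
def rowPairFactor (a b : ℕ) : ℚ := if b = 0 then 1 else ((a : ℚ) - b) / (a + b)

/-- The effect on `rowPairFactor` of shortening the row of length `a`, the other having
length `b`. -/
def rowPairRatio (a b : ℕ) : ℚ := if b = 0 then 1 else partRatio a b

theorem rowPairFactor_pred_left {a b : ℕ} (h : 0 < b → b < a) :
    rowPairFactor (a - 1) b = rowPairFactor a b * rowPairRatio a b := by
  rcases Nat.eq_zero_or_pos b with rfl | hb
  · simp [rowPairFactor, rowPairRatio]
  obtain ⟨c, rfl⟩ := Nat.exists_eq_add_of_lt (h hb)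
  rw [rowPairFactor, rowPairFactor, rowPairRatio, if_neg hb.ne', if_neg hb.ne', if_neg hb.ne',
    partRatio]
  have h0 : (0 : ℚ) < b := by exact_mod_cast hb
  have h1 : (0 : ℚ) ≤ c := by positivity
  push_cast [Nat.add_sub_cancel]
  have h2 : (b : ℚ) + c + b ≠ 0 := by positivity
  have h3 : (b : ℚ) + c + 1 + b ≠ 0 := by positivity
  have h4 : (b : ℚ) + c + 1 - b ≠ 0 := by rw [show (b : ℚ) + c + 1 - b = c + 1 by ring]; positivity
  have h5 : (b : ℚ) + c + 1 + b - 1 ≠ 0 := by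
    rw [show (b : ℚ) + c + 1 + b - 1 = b + c + b by ring]; positivity
  field_simp
  ring

/-- The ratio is the same as for shortening the longer row, because both the factor and its
shortened form change sign when the two rows are exchanged. -/
theorem rowPairFactor_pred_right {a c : ℕ} (ha : 0 < a) (h : a < c) :
    rowPairFactor c (a - 1) = rowPairFactor c a * rowPairRatio a c := by
  obtain ⟨d, rfl⟩ := Nat.exists_eq_add_of_lt h
  obtain ⟨a, rfl⟩ := Nat.exists_eq_succ_of_ne_zero ha.ne'
  simp only [rowPairFactor, rowPairRatio, partRatio, Nat.succ_eq_add_one, Nat.add_sub_cancel,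
    Nat.add_eq_zero_iff, one_ne_zero, and_false, if_false]
  push_cast
  have h0 : (0 : ℚ) ≤ a := by positivity
  have h1 : (0 : ℚ) ≤ d := by positivity
  have h2 : (a : ℚ) + 1 + d + 1 + (a + 1) ≠ 0 := by positivity
  have h3 : (a : ℚ) + 1 + (a + 1 + d + 1) ≠ 0 := by positivity
  have h4 : (a : ℚ) + 1 - (a + 1 + d + 1) ≠ 0 := by
    rw [show (a : ℚ) + 1 - (a + 1 + d + 1) = -(d + 1) by ring]
    exact neg_ne_zero.2 (by positivity)
  have h5 : (a : ℚ) + 1 + (a + 1 + d + 1) - 1 ≠ 0 := by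
    rw [show (a : ℚ) + 1 + (a + 1 + d + 1) - 1 = a + 1 + (a + d + 1) by ring]; positivity
  -- When a row of length 1 disappears, the conventional value 1 agrees with (c - 0)/(c + 0).
  split_ifs with ha
  · subst ha
    simp only [Nat.cast_zero, zero_add] at *
    field_simp
    ring
  · have h6 : (a : ℚ) + 1 + d + 1 + a ≠ 0 := by positivity
    field_simp
    ring

variable {n : ℕ}

/-- The number of standard fillings of the shifted shape with row lengths `l`. -/
def shapeWeight (l : Fin n → ℕ) : ℚ :=
  ((∑ i, l i)! : ℚ) * (∏ i, ((l i)! : ℚ)⁻¹) *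
    ∏ p : Fin n × Fin n with p.1 < p.2, rowPairFactor (l p.1) (l p.2)

/-- The row lengths decrease strictly until they vanish. -/
def IsStrictShape (l : Fin n → ℕ) : Prop := ∀ i j, i < j → 0 < l j → l j < l i

/-- Collects the changes of all pairs containing `k`, whether `k` is the smaller or the larger
index. -/
theorem prod_pair_ite (k : Fin n) (r : Fin n → ℚ) :
    ∏ p : Fin n × Fin n with p.1 < p.2,
      ((if p.1 = k then r p.2 else 1) * (if p.2 = k then r p.1 else 1)) =
      ∏ j ∈ Finset.univ.erase k, r j := by
  rw [Finset.prod_mul_distrib, Finset.prod_filter, Finset.prod_filter,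
    Fintype.prod_prod_type, Fintype.prod_prod_type_right]
  rw [Finset.prod_eq_single k
      (fun i _ hi => Finset.prod_eq_one fun j _ => by simp [hi]) (by simp),
    Finset.prod_eq_single k
      (fun i _ hi => Finset.prod_eq_one fun j _ => by simp [hi]) (by simp)]
  rw [← Finset.prod_mul_distrib, ← Finset.mul_prod_erase Finset.univ _ (Finset.mem_univ k)]
  simp only [lt_irrefl, if_false, one_mul, if_true]
  refine Finset.prod_congr rfl fun j hj => ?_
  rcases lt_or_gt_of_ne (Finset.ne_of_mem_erase hj) with h | h
  · simp [h, h.not_gt]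
  · simp [h, h.not_gt]

/-- Shortening row `k` divides the leading factorial by the size, multiplies 1/l_k! by l_k, and
alters only the pair factors involving `k`. -/
theorem shapeWeight_update {l : Fin n → ℕ} (hl : IsStrictShape l) {k : Fin n} (hk : 0 < l k) :
    shapeWeight (Function.update l k (l k - 1)) * (∑ i, l i : ℕ) =
      shapeWeight l * ((l k : ℚ) * ∏ j ∈ Finset.univ.erase k, rowPairRatio (l k) (l j)) := by
  have hne : ∀ j ∈ Finset.univ.erase k, Function.update l k (l k - 1) j = l j := fun j hj =>
    Function.update_of_ne (Finset.ne_of_mem_erase hj) _ _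
  have hsum : ∑ i, l i = ∑ i, Function.update l k (l k - 1) i + 1 := by
    have h1 : l k + ∑ i ∈ Finset.univ.erase k, l i = ∑ i, l i :=
      Finset.add_sum_erase _ _ (Finset.mem_univ k)
    have h2 : Function.update l k (l k - 1) k +
        ∑ i ∈ Finset.univ.erase k, Function.update l k (l k - 1) i =
        ∑ i, Function.update l k (l k - 1) i := Finset.add_sum_erase _ _ (Finset.mem_univ k)
    have h3 : ∑ i ∈ Finset.univ.erase k, Function.update l k (l k - 1) i =
        ∑ i ∈ Finset.univ.erase k, l i := Finset.sum_congr rfl hne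
    rw [h3, Function.update_self] at h2
    omega
  have hfact : ∏ i, ((Function.update l k (l k - 1) i)! : ℚ)⁻¹ =
      (∏ i, ((l i)! : ℚ)⁻¹) * l k := by
    rw [← Finset.mul_prod_erase Finset.univ _ (Finset.mem_univ k),
      ← Finset.mul_prod_erase Finset.univ (fun i => ((l i)! : ℚ)⁻¹) (Finset.mem_univ k),
      Finset.prod_congr rfl fun j hj => by rw [hne j hj], Function.update_self]
    have h1 : ((l k)! : ℚ) = l k * ((l k - 1)! : ℚ) := by
      exact_mod_cast (Nat.mul_factorial_pred hk.ne').symm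
    have h2 : (l k : ℚ) ≠ 0 := by exact_mod_cast hk.ne'
    have h3 : ((l k - 1)! : ℚ) ≠ 0 := by exact_mod_cast Nat.factorial_ne_zero _
    rw [h1]
    field_simp
  have hpair : ∏ p : Fin n × Fin n with p.1 < p.2,
      rowPairFactor (Function.update l k (l k - 1) p.1) (Function.update l k (l k - 1) p.2) =
      (∏ p : Fin n × Fin n with p.1 < p.2, rowPairFactor (l p.1) (l p.2)) *
        ∏ j ∈ Finset.univ.erase k, rowPairRatio (l k) (l j) := by
    rw [← prod_pair_ite, ← Finset.prod_mul_distrib]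
    refine Finset.prod_congr rfl ?_
    rintro ⟨i, j⟩ hij
    replace hij : i < j := (Finset.mem_filter.1 hij).2
    dsimp only
    by_cases hi : i = k
    · subst hi
      rw [Function.update_self, Function.update_of_ne hij.ne', if_pos rfl, if_neg hij.ne',
        mul_one, rowPairFactor_pred_left (hl i j hij)]
    · rw [Function.update_of_ne hi, if_neg hi, one_mul]
      by_cases hj : j = k
      · subst hj
        rw [Function.update_self, if_pos rfl, rowPairFactor_pred_right hk (hl i j hij hk)]
      · rw [Function.update_of_ne hj, if_neg hj, mul_one]
  rw [shapeWeight, shapeWeight, hfact, hpair, hsum, Nat.factorial_succ]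
  push_cast
  ring

/-- The weights satisfy the recursion of the numbers of standard fillings. -/
theorem sum_shapeWeight_update {l : Fin n → ℕ} (hl : IsStrictShape l) (hpos : 0 < ∑ i, l i) :
    ∑ k with 0 < l k, shapeWeight (Function.update l k (l k - 1)) = shapeWeight l := by
  have h0 : ((∑ i, l i : ℕ) : ℚ) ≠ 0 := by exact_mod_cast hpos.ne'
  refine mul_right_cancel₀ h0 ?_
  set Q : Finset (Fin n) := Finset.univ.filter fun k => 0 < l k with hQ
  have hQpos : ∀ i ∈ Q, 0 < l i := fun i hi => (Finset.mem_filter.1 hi).2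
  rw [Finset.sum_mul, Finset.sum_congr rfl fun k hk => shapeWeight_update hl (hQpos k hk),
    ← Finset.mul_sum]
  congr 1
  -- Nonempty rows have distinct lengths, as interpolation requires; empty rows have ratio 1 and
  -- drop out of the products.
  have hinj : Set.InjOn l Q := by
    intro i hi j hj hij
    rcases lt_trichotomy i j with h | h | h
    · exact absurd hij (hl i j h (hQpos j hj)).ne'
    · exact h
    · exact absurd hij (hl j i h (hQpos i hi)).ne
  have hsum : ((∑ i, l i : ℕ) : ℚ) = ∑ i ∈ Q, (l i : ℚ) := by
    rw [Nat.cast_sum, hQ, Finset.sum_filter]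
    refine Finset.sum_congr rfl fun i _ => ?_
    split_ifs with h
    · rfl
    · simp [Nat.eq_zero_of_not_pos h]
  rw [hsum, ← sum_mul_prod_partRatio Q l hQpos hinj]
  refine Finset.sum_congr rfl fun k _ => ?_
  congr 1
  have : Q.erase k = (Finset.univ.erase k).filter fun j => 0 < l j := by
    ext j; simp [hQ]
  rw [this, Finset.prod_filter]
  refine Finset.prod_congr rfl fun j _ => ?_
  rw [rowPairRatio]
  split_ifs with h1 h2 h2
  · omega
  · rfl
  · rfl
  · omega

/-- Two equal nonempty rows give a vanishing pair factor. Hence rows without a removable box may be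
included in the recursion at no cost. -/
theorem shapeWeight_update_eq_zero {l : Fin n → ℕ} {i j : Fin n} (hij : i < j) (hj : 0 < l j)
    (h : l i = l j + 1) : shapeWeight (Function.update l i (l i - 1)) = 0 := by
  refine mul_eq_zero_of_right _ (Finset.prod_eq_zero (i := (i, j)) (by simpa using hij) ?_)
  dsimp only
  rw [Function.update_self, Function.update_of_ne hij.ne', rowPairFactor, if_neg hj.ne', h]
  simp

theorem prod_rowPairFactor_range (t : ℕ) :
    ((t + 1)! : ℚ)⁻¹ * ∏ b ∈ Finset.range (t + 1), rowPairFactor (t + 1) b =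
      (t ! : ℚ) / ((2 * t + 1)! : ℚ) := by
  have h1 : ∏ b ∈ Finset.range t, ((t : ℚ) - b) = t ! := by
    rw [← Nat.descFactorial_self, Nat.descFactorial_eq_prod_range, Nat.cast_prod]
    exact Finset.prod_congr rfl fun b hb => by
      rw [Nat.cast_sub (Finset.mem_range.1 hb).le]
  have h2 : ((t + 1)! : ℚ) * ∏ b ∈ Finset.range t, ((t : ℚ) + 2 + b) = (2 * t + 1)! := by
    rw [show 2 * t + 1 = t + 1 + t by ring, ← Nat.factorial_mul_ascFactorial (t + 1) t,
      Nat.ascFactorial_eq_prod_range, Nat.cast_mul, Nat.cast_prod]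
    congr 1
    exact Finset.prod_congr rfl fun b _ => by push_cast; ring
  have h3 : ∏ b ∈ Finset.range t, rowPairFactor (t + 1) (b + 1) =
      ∏ b ∈ Finset.range t, (((t : ℚ) - b) / (t + 2 + b)) :=
    Finset.prod_congr rfl fun b _ => by
      rw [rowPairFactor, if_neg (Nat.succ_ne_zero b)]
      push_cast
      congr 1 <;> ring
  have h4 : rowPairFactor (t + 1) 0 = 1 := by simp [rowPairFactor]
  rw [Finset.prod_range_succ', h3, h4, mul_one, Finset.prod_div_distrib, h1, ← h2, mul_comm,
    ← div_eq_mul_inv, div_div, mul_comm (Finset.prod _ _)]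

theorem shapeWeight_staircase (n : ℕ) (N : ℕ) (hN : ∑ i : Fin n, (n - 1 - (i : ℕ)) = N) :
    shapeWeight (fun i : Fin n => n - 1 - (i : ℕ)) =
      (N ! : ℚ) * ∏ i ∈ Finset.range (n - 1), ((i ! : ℚ) / ((2 * i + 1)! : ℚ)) := by
  have hrev : ∀ i : Fin n, n - 1 - ((Fin.rev i : Fin n) : ℕ) = i := fun i => by
    rw [Fin.val_rev]; omega
  rw [shapeWeight, hN, mul_assoc]
  congr 1
  have h1 : ∏ i : Fin n, (((n - 1 - (i : ℕ))! : ℕ) : ℚ)⁻¹ = ∏ i : Fin n, ((i : ℕ)! : ℚ)⁻¹ := by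
    rw [← Equiv.prod_comp Fin.revPerm]
    exact Finset.prod_congr rfl fun i _ => by rw [Fin.revPerm_apply, hrev]
  have h2 : ∏ p : Fin n × Fin n with p.1 < p.2,
      rowPairFactor (n - 1 - (p.1 : ℕ)) (n - 1 - (p.2 : ℕ)) =
      ∏ i : Fin n, ∏ b ∈ Finset.range i, rowPairFactor i b := by
    rw [Finset.prod_filter, ← Equiv.prod_comp (Equiv.prodCongr Fin.revPerm Fin.revPerm),
      Fintype.prod_prod_type]
    refine Finset.prod_congr rfl fun i _ => ?_
    simp only [Equiv.prodCongr_apply, Prod.map, Fin.revPerm_apply, hrev, Fin.rev_lt_rev]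
    simp only [Fin.lt_def]
    rw [Fin.prod_univ_eq_prod_range (fun b => if b < (i : ℕ) then rowPairFactor i b else 1) n,
      ← Finset.prod_filter]
    refine Finset.prod_congr ?_ fun _ _ => rfl
    ext b
    have := i.2
    simp only [Finset.mem_filter, Finset.mem_range]
    omega
  rw [h1, h2, ← Finset.prod_mul_distrib, Fin.prod_univ_eq_prod_range
    (fun i => ((i ! : ℕ) : ℚ)⁻¹ * ∏ b ∈ Finset.range i, rowPairFactor i b) n]
  cases n with
  | zero => simp
  | succ m =>
    -- The empty row contributes 1; the row of length t + 1 gives the factor of index t.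
    rw [Finset.prod_range_succ', Nat.add_sub_cancel]
    simp only [prod_rowPairFactor_range]
    simp

end Weight

/-! ### Counting standard fillings by removing the largest entry -/

section Fillings

variable {P : Type*} [PartialOrder P] [Fintype P]

open Classical in
/-- The standard fillings of a finite set `I` of an order, extended by zero. -/
noncomputable def standardFillings (I : Finset P) : Finset (P → ℕ) :=
  (Fintype.piFinset fun _ => Finset.range (I.card + 1)).filter fun f =>
    (∀ x ∉ I, f x = 0) ∧ (∀ x ∈ I, f x < I.card) ∧ Set.InjOn f I ∧ StrictMonoOn f I

theorem mem_standardFillings {I : Finset P} {f : P → ℕ} : f ∈ standardFillings I ↔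
    (∀ x ∉ I, f x = 0) ∧ (∀ x ∈ I, f x < I.card) ∧ Set.InjOn f I ∧ StrictMonoOn f I := by
  classical
  rw [standardFillings, Finset.mem_filter, Fintype.mem_piFinset, and_iff_right_iff_imp]
  rintro ⟨h1, h2, -⟩ x
  rw [Finset.mem_range]
  by_cases hx : x ∈ I
  · exact (h2 x hx).trans (Nat.lt_succ_self _)
  -- The bound `I.card + 1` admits the default value 0 even for empty `I`.
  · rw [h1 x hx]; exact Nat.succ_pos _

theorem card_standardFillings_empty : (standardFillings (∅ : Finset P)).card = 1 := by
  rw [Finset.card_eq_one]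
  refine ⟨fun _ => 0, ?_⟩
  ext f
  rw [mem_standardFillings, Finset.mem_singleton, funext_iff]
  simp [StrictMonoOn]

open Classical in
/-- The maximal elements of a finite set. -/
noncomputable def maximalElements (I : Finset P) : Finset P := I.filter fun b => ∀ x ∈ I, ¬b < x

theorem mem_maximalElements {I : Finset P} {b : P} :
    b ∈ maximalElements I ↔ b ∈ I ∧ ∀ x ∈ I, ¬b < x := by
  simp [maximalElements]

theorem update_mem_standardFillings [DecidableEq P] {I : Finset P} {b : P}
    (hb : b ∈ maximalElements I) {g : P → ℕ} (hg : g ∈ standardFillings (I.erase b)) :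
    Function.update g b (I.card - 1) ∈ standardFillings I := by
  rw [mem_maximalElements] at hb
  rw [mem_standardFillings] at hg ⊢
  obtain ⟨h1, h2, h3, h4⟩ := hg
  rw [Finset.card_erase_of_mem hb.1] at h2
  have hpos : 0 < I.card := Finset.card_pos.2 ⟨b, hb.1⟩
  have hmem : ∀ {x}, x ∈ I → x ≠ b → x ∈ I.erase b := fun hx hxb => Finset.mem_erase.2 ⟨hxb, hx⟩
  refine ⟨fun x hx => ?_, fun x hx => ?_, fun x hx y hy hxy => ?_, fun x hx y hy hxy => ?_⟩
  · have hxb : x ≠ b := by rintro rfl; exact hx hb.1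
    rw [Function.update_of_ne hxb]
    exact h1 x fun h => hx (Finset.mem_of_mem_erase h)
  · by_cases hxb : x = b
    · subst hxb; rw [Function.update_self]; omega
    · rw [Function.update_of_ne hxb]; have := h2 x (hmem hx hxb); omega
  · by_cases hxb : x = b <;> by_cases hyb : y = b
    · rw [hxb, hyb]
    · subst hxb
      rw [Function.update_self, Function.update_of_ne hyb] at hxy
      exact absurd hxy (h2 y (hmem hy hyb)).ne'
    · subst hyb
      rw [Function.update_self, Function.update_of_ne hxb] at hxy
      exact absurd hxy (h2 x (hmem hx hxb)).ne
    · rw [Function.update_of_ne hxb, Function.update_of_ne hyb] at hxy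
      exact h3 (hmem hx hxb) (hmem hy hyb) hxy
  · have hxb : x ≠ b := by rintro rfl; exact hb.2 y hy hxy
    rw [Function.update_of_ne hxb]
    by_cases hyb : y = b
    · subst hyb; rw [Function.update_self]; exact h2 x (hmem hx hxb)
    · rw [Function.update_of_ne hyb]
      exact h4 (hmem hx hxb) (hmem hy hyb) hxy

theorem exists_update_eq_of_mem_standardFillings [DecidableEq P] {I : Finset P}
    (hI : I.Nonempty) {f : P → ℕ} (hf : f ∈ standardFillings I) :
    ∃ b ∈ maximalElements I, ∃ g ∈ standardFillings (I.erase b),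
      Function.update g b (I.card - 1) = f := by
  rw [mem_standardFillings] at hf
  obtain ⟨h1, h2, h3, h4⟩ := hf
  have hpos : 0 < I.card := hI.card_pos
  -- By counting, every value below `I.card` occurs; the largest one marks the box to remove.
  have himage : I.image f = Finset.range I.card :=
    Finset.eq_of_subset_of_card_le
      (fun y hy => by
        obtain ⟨x, hx, rfl⟩ := Finset.mem_image.1 hy
        exact Finset.mem_range.2 (h2 x hx))
      (by rw [Finset.card_range, Finset.card_image_of_injOn h3])
  obtain ⟨b, hb, hfb⟩ : ∃ b ∈ I, f b = I.card - 1 := by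
    rw [← Finset.mem_image, himage, Finset.mem_range]; omega
  refine ⟨b, mem_maximalElements.2 ⟨hb, fun x hx hbx => ?_⟩, Function.update f b 0, ?_, ?_⟩
  · have := h4 hb hx hbx
    have := h2 x hx
    omega
  · have hup : ∀ {x}, x ∈ I.erase b → Function.update f b 0 x = f x := fun hx =>
      Function.update_of_ne (Finset.ne_of_mem_erase hx) _ _
    rw [mem_standardFillings]
    refine ⟨fun x hx => ?_, fun x hx => ?_, fun x hx y hy hxy => ?_, fun x hx y hy hxy => ?_⟩
    · by_cases hxb : x = b
      · subst hxb; rw [Function.update_self]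
      · rw [Function.update_of_ne hxb]
        exact h1 x fun h => hx (Finset.mem_erase.2 ⟨hxb, h⟩)
    · rw [hup hx, Finset.card_erase_of_mem hb]
      have hne : f x ≠ f b := fun h => Finset.ne_of_mem_erase hx
        (h3 (Finset.mem_of_mem_erase hx) hb h)
      have := h2 x (Finset.mem_of_mem_erase hx)
      omega
    · rw [hup hx, hup hy] at hxy
      exact h3 (Finset.mem_of_mem_erase hx) (Finset.mem_of_mem_erase hy) hxy
    · rw [hup hx, hup hy]
      exact h4 (Finset.mem_of_mem_erase hx) (Finset.mem_of_mem_erase hy) hxy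
  · rw [Function.update_idem, ← hfb, Function.update_eq_self]

/-- Standard fillings are counted by removing the box with the largest entry. -/
theorem card_standardFillings [DecidableEq P] {I : Finset P} (hI : I.Nonempty) :
    (standardFillings I).card =
      ∑ b ∈ maximalElements I, (standardFillings (I.erase b)).card := by
  have h : standardFillings I = (maximalElements I).biUnion fun b =>
      (standardFillings (I.erase b)).image fun g => Function.update g b (I.card - 1) := by
    ext f
    simp only [Finset.mem_biUnion, Finset.mem_image]
    constructor
    · exact exists_update_eq_of_mem_standardFillings hI
    · rintro ⟨b, hb, g, hg, rfl⟩
      exact update_mem_standardFillings hb hg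
  rw [h, Finset.card_biUnion]
  · refine Finset.sum_congr rfl fun b _ => Finset.card_image_of_injOn fun g hg g' hg' hgg' => ?_
    have h1 := (mem_standardFillings.1 hg).1 b (Finset.notMem_erase b I)
    have h2 := (mem_standardFillings.1 hg').1 b (Finset.notMem_erase b I)
    ext x
    by_cases hx : x = b
    · rw [hx, h1, h2]
    · simpa [hx] using congrFun hgg' x
  -- A common filling would have its largest entry at both `b` and `c`.
  · intro b hb c hc hbc
    rw [Function.onFun, Finset.disjoint_left]
    intro f hf hf'
    obtain ⟨g, hg, rfl⟩ := Finset.mem_image.1 hf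
    obtain ⟨g', -, hgg'⟩ := Finset.mem_image.1 hf'
    have h1 := (mem_standardFillings.1 (update_mem_standardFillings hb hg)).2.2.1
    refine hbc (h1 (mem_maximalElements.1 hb).1 (mem_maximalElements.1 hc).1 ?_)
    rw [← hgg', Function.update_self]
    simpa [hbc] using congrFun hgg' b

theorem card_linearExtensions {N : ℕ} (hN : Fintype.card P = N) :
    Nat.card {f : P ≃ Fin N // StrictMono f} = (standardFillings (Finset.univ : Finset P)).card := by
  have hcard : Nat.card {g // g ∈ standardFillings (Finset.univ : Finset P)} =
      (standardFillings (Finset.univ : Finset P)).card := by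
    rw [Nat.card_eq_fintype_card, Fintype.card_coe]
  rw [← hcard]
  refine Nat.card_congr (Equiv.ofBijective (fun f => ⟨fun x => (f.1 x : ℕ), ?_⟩) ⟨?_, ?_⟩)
  · rw [mem_standardFillings]
    refine ⟨fun x hx => absurd (Finset.mem_univ x) hx, fun x _ => ?_, fun x _ y _ hxy => ?_,
      fun x _ y _ hxy => f.2 hxy⟩
    · rw [Finset.card_univ, hN]; exact (f.1 x).2
    · exact f.1.injective (Fin.ext hxy)
  · intro f g hfg
    apply Subtype.ext
    ext x
    exact congrFun (congrArg Subtype.val hfg) x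
  · rintro ⟨g, hg⟩
    obtain ⟨-, h2, h3, h4⟩ := mem_standardFillings.1 hg
    rw [Finset.card_univ, hN] at h2
    have hbij : Function.Bijective fun x => (⟨g x, h2 x (Finset.mem_univ x)⟩ : Fin N) := by
      rw [Fintype.bijective_iff_injective_and_card]
      refine ⟨fun x y hxy => ?_, by rw [hN, Fintype.card_fin]⟩
      exact h3 (by simp) (by simp) (Fin.mk.inj_iff.1 hxy)
    exact ⟨⟨Equiv.ofBijective _ hbij, fun x y hxy => h4 (by simp) (by simp) hxy⟩, rfl⟩

end Fillings

/-! ### Row lengths of lower sets and the product formula -/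

section RowLengths

variable {n : ℕ}

/-- The row lengths of a set of boxes. -/
def rowLength (I : Finset (StaircaseBox n)) (i : Fin n) : ℕ := (I.filter fun c => c.1.1 = i).card

theorem sum_rowLength (I : Finset (StaircaseBox n)) : ∑ i, rowLength I i = I.card :=
  (Finset.card_eq_sum_card_fiberwise (f := fun c : StaircaseBox n => c.1.1)
    (fun _ _ => Finset.mem_coe.2 (Finset.mem_univ _))).symm

theorem rowLength_erase {I : Finset (StaircaseBox n)} {b : StaircaseBox n} (hb : b ∈ I) :
    rowLength (I.erase b) = Function.update (rowLength I) b.1.1 (rowLength I b.1.1 - 1) := by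
  ext i
  rw [rowLength, Finset.filter_erase]
  by_cases hi : i = b.1.1
  · subst hi
    rw [Function.update_self, Finset.card_erase_of_mem (by simp [hb]), rowLength]
  · rw [Function.update_of_ne hi, Finset.erase_eq_of_notMem (by simp [Ne.symm hi]), rowLength]

/-- A lower set fills each row from the left, and row i starts in column i + 1. -/
theorem mem_iff_le_rowLength {I : Finset (StaircaseBox n)}
    (hI : IsLowerSet (I : Set (StaircaseBox n))) (c : StaircaseBox n) :
    c ∈ I ↔ (c.1.2 : ℕ) ≤ c.1.1 + rowLength I c.1.1 := by
  obtain ⟨⟨i, j⟩, hij⟩ := c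
  have hij' : (i : ℕ) < j := hij
  have hcol : ∀ s : Finset (StaircaseBox n), (∀ c ∈ s, c.1.1 = i) →
      (s.image fun c => c.1.2).card = s.card := fun s hs =>
    Finset.card_image_of_injOn fun c hc d hd hcd =>
      Subtype.ext (Prod.ext ((hs c hc).trans (hs d hd).symm) hcd)
  have hrow := hcol (I.filter fun c => c.1.1 = i) fun c hc => (Finset.mem_filter.1 hc).2
  change _ = rowLength I i at hrow
  dsimp only
  constructor
  · intro hc
    have hsub : Finset.Ioc i j ⊆ (I.filter fun c => c.1.1 = i).image fun c => c.1.2 := by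
      intro k hk
      rw [Finset.mem_Ioc] at hk
      refine Finset.mem_image.2 ⟨⟨(i, k), hk.1⟩, Finset.mem_filter.2 ⟨?_, rfl⟩, rfl⟩
      exact hI (show (⟨(i, k), hk.1⟩ : StaircaseBox n) ≤ ⟨(i, j), hij⟩ from ⟨le_rfl, hk.2⟩) hc
    have := Finset.card_le_card hsub
    rw [Fin.card_Ioc, hrow] at this
    omega
  · intro hle
    by_contra hc
    have hsub : ((I.filter fun c => c.1.1 = i).image fun c => c.1.2) ⊆ Finset.Ioo i j := by
      intro k hk
      obtain ⟨⟨⟨i', k'⟩, hik⟩, hd, rfl⟩ := Finset.mem_image.1 hk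
      obtain ⟨hd', rfl⟩ := Finset.mem_filter.1 hd
      refine Finset.mem_Ioo.2 ⟨hik, lt_of_not_ge fun h => hc ?_⟩
      exact hI (show (⟨(i', j), hij⟩ : StaircaseBox n) ≤ ⟨(i', k'), hik⟩ from ⟨le_rfl, h⟩) hd'
    have := Finset.card_le_card hsub
    rw [Fin.card_Ioo, hrow] at this
    omega

/-- The last box of a nonempty row. -/
theorem exists_last_box {I : Finset (StaircaseBox n)}
    (hI : IsLowerSet (I : Set (StaircaseBox n))) {i : Fin n} (hi : 0 < rowLength I i) :
    ∃ c ∈ I, c.1.1 = i ∧ (c.1.2 : ℕ) = i + rowLength I i := by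
  have hlt : (i : ℕ) + rowLength I i < n := by
    by_contra hge
    have hsub : ((I.filter fun c => c.1.1 = i).image fun c => c.1.2) ⊆ Finset.Ioi i := by
      intro k hk
      obtain ⟨d, hd, rfl⟩ := Finset.mem_image.1 hk
      rw [Finset.mem_Ioi, ← (Finset.mem_filter.1 hd).2]
      exact d.2
    have h1 := Finset.card_le_card hsub
    rw [Fin.card_Ioi, Finset.card_image_of_injOn fun c hc d hd hcd =>
      Subtype.ext (Prod.ext ((Finset.mem_filter.1 hc).2.trans (Finset.mem_filter.1 hd).2.symm) hcd)]
      at h1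
    change rowLength I i ≤ _ at h1
    have := i.2
    omega
  refine ⟨⟨(i, ⟨i + rowLength I i, hlt⟩), Fin.lt_def.2 (by simpa using hi)⟩, ?_, rfl, rfl⟩
  rw [mem_iff_le_rowLength hI]

/-- Row `i` reaches at least the last column of row `j`, and it starts further to the left. -/
theorem isStrictShape_rowLength {I : Finset (StaircaseBox n)}
    (hI : IsLowerSet (I : Set (StaircaseBox n))) : IsStrictShape (rowLength I) := by
  intro i j hij hj
  obtain ⟨⟨⟨j', k⟩, hjk⟩, hc, rfl, hk⟩ := exists_last_box hI hj
  dsimp only at *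
  have h1 : (⟨(i, k), hij.trans hjk⟩ : StaircaseBox n) ∈ I :=
    hI (show (⟨(i, k), hij.trans hjk⟩ : StaircaseBox n) ≤ ⟨(j', k), hjk⟩ from
      ⟨hij.le, le_rfl⟩) hc
  have h2 := (mem_iff_le_rowLength hI _).1 h1
  have h3 : (i : ℕ) < j' := hij
  dsimp only at h2
  omega

/-- If the last box of a row is not maximal then the next row is shorter by one only. -/
theorem exists_rowLength_eq_add_one {I : Finset (StaircaseBox n)}
    (hI : IsLowerSet (I : Set (StaircaseBox n))) {c : StaircaseBox n} (hc : c ∈ I)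
    (hlast : (c.1.2 : ℕ) = c.1.1 + rowLength I c.1.1) (hmax : c ∉ maximalElements I) :
    ∃ j, c.1.1 < j ∧ 0 < rowLength I j ∧ rowLength I c.1.1 = rowLength I j + 1 := by
  rw [mem_maximalElements] at hmax
  push Not at hmax
  obtain ⟨d, hd, hcd⟩ := hmax hc
  obtain ⟨⟨i, k⟩, hik⟩ := c
  obtain ⟨⟨i', k'⟩, hik'⟩ := d
  have hi : (i : ℕ) ≤ i' := hcd.le.1
  have hk : (k : ℕ) ≤ k' := hcd.le.2
  have hlt' : (i' : ℕ) < k' := hik'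
  dsimp only at *
  have hd' := (mem_iff_le_rowLength hI _).1 hd
  dsimp only at hd'
  have hne : i ≠ i' := by
    rintro rfl
    have : k' = k := Fin.ext (by omega)
    subst this
    exact hcd.ne rfl
  have hlt : i < i' := lt_of_le_of_ne hcd.le.1 hne
  have h1 : (i : ℕ) < i' := hlt
  have hs := isStrictShape_rowLength hI
  have h2 := hs i i' hlt (by omega)
  -- The box directly below `c` still lies under `d`, hence in `I`. So row i + 1 reaches the last
  -- column of row i, and strictness leaves a difference of exactly one.
  let j : Fin n := ⟨i + 1, by have := i'.2; omega⟩
  have hij : i < j := Fin.lt_def.2 (Nat.lt_succ_self _)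
  have hjk : j < k := Fin.lt_def.2 (show (i : ℕ) + 1 < k by omega)
  have h3 : (⟨(j, k), hjk⟩ : StaircaseBox n) ∈ I :=
    hI (show (⟨(j, k), hjk⟩ : StaircaseBox n) ≤ ⟨(i', k'), hik'⟩ from
      ⟨Fin.le_def.2 (show (i : ℕ) + 1 ≤ i' by omega), hcd.le.2⟩) hd
  have h4 := (mem_iff_le_rowLength hI _).1 h3
  change (k : ℕ) ≤ (i + 1) + rowLength I j at h4
  have h5 : (i : ℕ) + 1 < k := hjk
  have h6 := hs i j hij (by omega)
  exact ⟨j, hij, by omega, by omega⟩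

/-- The number of standard fillings of a shifted shape. -/
theorem card_standardFillings_eq_shapeWeight {I : Finset (StaircaseBox n)}
    (hI : IsLowerSet (I : Set (StaircaseBox n))) :
    ((standardFillings I).card : ℚ) = shapeWeight (rowLength I) := by
  induction h : I.card generalizing I with
  | zero =>
    rw [Finset.card_eq_zero] at h
    subst h
    have : rowLength (∅ : Finset (StaircaseBox n)) = fun _ => 0 := by ext; simp [rowLength]
    rw [card_standardFillings_empty, this]
    simp [shapeWeight, rowPairFactor]
  | succ m ih =>
    have hne : I.Nonempty := Finset.card_pos.1 (by omega)
    have hs := isStrictShape_rowLength hI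
    rw [card_standardFillings hne, Nat.cast_sum,
      ← sum_shapeWeight_update hs (by rw [sum_rowLength, h]; omega)]
    have hterm : ∀ b ∈ maximalElements I, ((standardFillings (I.erase b)).card : ℚ) =
        shapeWeight (Function.update (rowLength I) b.1.1 (rowLength I b.1.1 - 1)) := by
      intro b hb
      rw [mem_maximalElements] at hb
      rw [← rowLength_erase hb.1]
      refine ih ?_ (by rw [Finset.card_erase_of_mem hb.1, h]; rfl)
      intro x y hyx hx
      rw [Finset.mem_coe, Finset.mem_erase] at hx ⊢
      refine ⟨?_, hI hyx hx.2⟩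
      rintro rfl
      exact hb.2 x hx.2 (lt_of_le_of_ne hyx hx.1.symm)
    rw [Finset.sum_congr rfl hterm]
    -- A row has at most one maximal box, so the sum over maximal boxes becomes a sum over rows.
    have hinj : Set.InjOn (fun c : StaircaseBox n => c.1.1) (maximalElements I) := by
      rintro ⟨⟨i, j⟩, hij⟩ hc ⟨⟨i', j'⟩, hij'⟩ hd hcd
      rw [Finset.mem_coe, mem_maximalElements] at hc hd
      obtain rfl : i = i' := hcd
      have hlt : ∀ {k l : Fin n} (hk : i < k) (hl : i < l), k < l →
          (⟨(i, k), hk⟩ : StaircaseBox n) < ⟨(i, l), hl⟩ := fun _ _ h =>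
        Prod.mk_lt_mk.2 (Or.inr ⟨le_rfl, h⟩)
      rcases lt_trichotomy j j' with hj | rfl | hj
      · exact absurd (hlt _ _ hj) (hc.2 _ hd.1)
      · rfl
      · exact absurd (hlt _ _ hj) (hd.2 _ hc.1)
    rw [← Finset.sum_image (f := fun i => shapeWeight
      (Function.update (rowLength I) i (rowLength I i - 1))) hinj]
    -- The remaining nonempty rows, whose last box is not maximal, have weight zero after
    -- shortening.
    refine Finset.sum_subset ?_ ?_
    · intro i hi
      obtain ⟨c, hc, rfl⟩ := Finset.mem_image.1 hi
      rw [Finset.mem_filter]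
      refine ⟨Finset.mem_univ _, Finset.card_pos.2 ⟨c, ?_⟩⟩
      exact Finset.mem_filter.2 ⟨(mem_maximalElements.1 hc).1, rfl⟩
    · intro i hi hi'
      obtain ⟨c, hc, rfl, hlast⟩ := exists_last_box hI (Finset.mem_filter.1 hi).2
      obtain ⟨j, hij, hj, heq⟩ := exists_rowLength_eq_add_one hI hc hlast
        fun h => hi' (Finset.mem_image.2 ⟨c, h, rfl⟩)
      exact shapeWeight_update_eq_zero hij hj heq

theorem rowLength_univ (i : Fin n) :
    rowLength (Finset.univ : Finset (StaircaseBox n)) i = n - 1 - (i : ℕ) := by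
  rw [← Fin.card_Ioi, rowLength]
  refine Finset.card_bij (fun c _ => c.1.2) ?_ ?_ ?_
  · intro c hc
    rw [Finset.mem_Ioi, ← (Finset.mem_filter.1 hc).2]
    exact c.2
  · intro c hc d hd hcd
    exact Subtype.ext (Prod.ext
      ((Finset.mem_filter.1 hc).2.trans (Finset.mem_filter.1 hd).2.symm) hcd)
  · intro j hj
    exact ⟨⟨(i, j), Finset.mem_Ioi.1 hj⟩, by simp, rfl⟩

/-- The product formula for the number of standard tableaux of shifted staircase shape. -/
theorem card_shiftedStaircaseSYT (n : ℕ) : (Nat.card (ShiftedStaircaseSYT n) : ℚ) =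
    ((n.choose 2)! : ℚ) * ∏ i ∈ Finset.range (n - 1), ((i ! : ℚ) / ((2 * i + 1)! : ℚ)) := by
  rw [Nat.card_congr (shiftedStaircaseSYTEquiv n), card_linearExtensions (card_staircaseBox n),
    card_standardFillings_eq_shapeWeight (by simpa using isLowerSet_univ), funext rowLength_univ]
  refine shapeWeight_staircase n _ ?_
  rw [← card_staircaseBox, ← Finset.card_univ, ← sum_rowLength]
  exact Finset.sum_congr rfl fun i _ => (rowLength_univ i).symm

end RowLengths

theorem mainTheorem4 (n : ℕ) (hn : 2 < n) :
    Nat.card (Flag (WeakUnimodal n)) = 2 * Nat.card (ShiftedStaircaseSYT n) ∧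
      (Nat.card (Flag (WeakUnimodal n)) : ℚ) =
        2 * ((n.choose 2)! : ℚ) *
          ∏ i ∈ Finset.range (n - 1), ((i ! : ℚ) / ((2 * i + 1)! : ℚ)) := by
  have h1 : Nat.card (Flag (WeakUnimodal n)) = 2 * Nat.card (ShiftedStaircaseSYT n) := by
    rw [card_flag_weakUnimodal hn, card_flag_lowerSet_staircaseBox]
  refine ⟨h1, ?_⟩
  rw [h1, Nat.cast_mul, card_shiftedStaircaseSYT, Nat.cast_two, mul_assoc]
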